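/- Let $E$ be a finite non-empty set of phases, $N=|E|$, and let $(X_n,J_n)_{n\ge 0}$ be an upward skip-free Markov additive chain on $\mathbb Z\times E$, possibly killed: a Markov chain which moves from $(x,i)$ to $(x+m,j)$ with probability $(A_m)_{ij}\ge 0$, where $A_m=0$ for $m\ge 2$, and which in each step is sent to an absorbing cemetery with a constant probability $p^\dagger\in[0,1)$, so that $\sum_{m,j}(A_m)_{ij}=1-p^\dagger$ for every $i\in E$. Assume that $\sum_m A_m$ is irreducible and that $A_1$ is invertible. Let $X_0=0$, and write $\mathbb P(B, J_T)$ for the $N\times N$ matrix with entries $\mathbb P(B, T<\infty, J_T=j\mid X_0=0, J_0=i)$, where $T<\infty$ means that $T$ occurs, before killing; $\mathbb P(J_T)$ is the case where $B$ is the sure event. For $x\in\mathbb Z$ let $$\tau^{\{x\}}=\inf\{n\ge 0:X_n=x\},\quad \tau_x^+=\inf\{n\ge 0:X_n\ge x\},\quad \tau_x^-=\inf\{n\ge 0: X_n\le x\},$$ where only times before killing count and $\inf\emptyset=\infty$. Put $$F(z)=\sum_{m\ge -1}z^mA_{-m}\ (0<z\le 1),\qquad G=\mathbb P(J_{\tau^{\{1\}}}),\qquad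 \gamma=\min\{|\lambda|:\lambda \text{ an eigenvalue of } G\}.$$ Let $L\in[0,\infty]^{N\times N}$ have as $(i,j)$ entry the expected total number of visits to the state $(0,j)$ when starting from $(0,i)$, and let $L(n)$ be the matrix of expected numbers of visits to $(0,j)$ made up to time $\tau^{\{n\}}$. Then $G$ is invertible, $\gamma>0$, $L(n)$ has finite entries for every $n\ge 1$, and there is a function $W:\mathbb N\to\mathbb R^{N\times N}$ with the following properties. 1. $W(0)=0$, $W(n)$ is invertible for every $n\ge 1$, and for all integers $a,b\ge 1$ $$\mathbb P\bigl(\tau_a^+<\tau_{-b}^-,\,J_{\tau_a^+}\bigr)=W(b)\,W(a+b)^{-1}.\tag{1}$$ 2. For every $z\in(0,\gamma)$ the matrix $F(z)-I$ is invertible, the series below converges, and $$\sum_{n=0}^\infty z^nW(n)=(F(z)-I)^{-1}.\tag{2}$$ 3. (Uniqueness) A function $W'$ with $W'(0)=0$ and $W'(n)$ invertible for all $n\ge1$ satisfies (1) if and only if $W'(n)=W(n)C$ for all $n$, with some constant invertible matrix $C$. If $W'$ satisfies (2) as well, then $W'=W$. 4. If $L$ has finite entries, then $W(n)=\bigl(G^{-n}-\mathbb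 P(J_{\tau^{\{-n\}}})\bigr)L$ for all $n\ge 0$. 5. $W(n)=G^{-n}L(n)$ for all $n\ge 1$. -/

import Mathlib

open MeasureTheory
open scoped ENNReal

/-- The data of an upward skip-free (killed) Markov additive chain with finite phase space `E`.
`A m i j` is the probability that, from phase `i`, in one step the level changes by `m`, the phase
becomes `j` and the chain is not killed; `killing` is the probability of being killed in one step.
The phase transition matrix is `∑ m, A m`. -/
structure MarkovAdditiveChain (E : Type*) [Fintype E] where
  A : ℤ → Matrix E E ℝ
  killing : ℝ
  nonneg : ∀ m i j, 0 ≤ A m i j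
  killing_nonneg : 0 ≤ killing
  killing_lt_one : killing < 1
  hasSum_row : ∀ i, HasSum (fun s : ℤ × E => A s.1 i s.2) (1 - killing)
  skipFree : ∀ m, 1 < m → A m = 0
  irreducible : (Matrix.of fun i j => ∑' m : ℤ, A m i j).IsIrreducible

namespace MarkovAdditiveChain

/-- States of the bivariate chain: `some (x, i)` is level `x` and phase `i`,
`none` is the cemetery. -/
abbrev State (E : Type*) := Option (ℤ × E)

section Law

variable {E : Type*} [Fintype E] (M : MarkovAdditiveChain E)

/-- One-step transition probabilities of the killed bivariate chain. -/
def trans : State E → State E → ℝ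
  | some (x, i), some (y, j) => M.A (y - x) i j
  | some _, none => M.killing
  | none, some _ => 0
  | none, none => 1

/-- The matrix generating function `F(z) = ∑_{m ≥ -1} z ^ m A_{-m}`, i.e. `E(z ^ (-X₁); J₁)`
(the blocks `A_{-m}` with `m < -1` vanish). -/
noncomputable def F (z : ℝ) : Matrix E E ℝ :=
  Matrix.of fun i j => ∑' m : ℤ, z ^ m * M.A (-m) i j

/-- Under `P i`, the process `Z` is a Markov chain with transition probabilities `M.trans`,
started at level `0` and phase `i`. So `P i` is the conditional law given `X₀ = 0, J₀ = i`. -/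
structure IsRealization {Ω : Type*} [MeasurableSpace Ω] (P : E → Measure Ω)
    (Z : ℕ → Ω → State E) : Prop where
  measurable : ∀ n s, MeasurableSet {ω | Z n ω = s}
  initial : ∀ i, P i {ω | Z 0 ω = some (0, i)} = 1
  markov : ∀ i n (s : ℕ → State E),
    (P i).real {ω | ∀ k ≤ n + 1, Z k ω = s k} =
      (P i).real {ω | ∀ k ≤ n, Z k ω = s k} * M.trans (s n) (s (n + 1))

end Law

section Times

variable {E Ω : Type*} (Z : ℕ → Ω → State E)

/-- First time the level equals `x` (`⊤` if this never happens). -/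
noncomputable def hitTime (x : ℤ) : Ω → WithTop ℕ :=
  hittingAfter Z {s | ∃ j, s = some (x, j)} 0

/-- First time the level is at least `x`. -/
noncomputable def upTime (x : ℤ) : Ω → WithTop ℕ :=
  hittingAfter Z {s | ∃ y j, s = some (y, j) ∧ x ≤ y} 0

/-- First time the level is at most `x`. -/
noncomputable def downTime (x : ℤ) : Ω → WithTop ℕ :=
  hittingAfter Z {s | ∃ y j, s = some (y, j) ∧ y ≤ x} 0

/-- The event that the time `T` is finite and the phase at time `T` is `j`. -/
def phaseAt (T : Ω → WithTop ℕ) (j : E) : Set Ω :=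
  {ω | ∃ n : ℕ, T ω = n ∧ ∃ x, Z n ω = some (x, j)}

/-- Number of visits to level `x` and phase `j` up to and including time `T`. -/
noncomputable def occupation (x : ℤ) (j : E) (T : Ω → WithTop ℕ) (ω : Ω) : ℝ≥0∞ :=
  ∑' k : ℕ, {ω | (k : WithTop ℕ) ≤ T ω ∧ Z k ω = some (x, j)}.indicator 1 ω

end Times

section Matrices

variable {E Ω : Type*} [MeasurableSpace Ω] (P : E → Measure Ω) (Z : ℕ → Ω → State E)

/-- The matrix `P(J_{τ^{x}})` of phases at the first hitting time of level `x`. -/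
noncomputable def hitMatrix (x : ℤ) : Matrix E E ℝ :=
  Matrix.of fun i j => (P i).real (phaseAt Z (hitTime Z x) j)

/-- The fundamental matrix `G = P(J_{τ^{1}})`. -/
noncomputable def G : Matrix E E ℝ := hitMatrix P Z 1

/-- The matrix `P(τ_a^+ < τ_{-b}^-, J_{τ_a^+})` of two-sided upward exit. -/
noncomputable def exitUp (a b : ℕ) : Matrix E E ℝ :=
  Matrix.of fun i j =>
    (P i).real ({ω | upTime Z a ω < downTime Z (-(b : ℤ)) ω} ∩ phaseAt Z (upTime Z a) j)

/-- The matrix of expected numbers of visits to level `0`, over the infinite time horizon.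
Its entries may be infinite. -/
noncomputable def L : Matrix E E ℝ≥0∞ :=
  Matrix.of fun i j => ∫⁻ ω, occupation Z 0 j (fun _ => ⊤) ω ∂(P i)

/-- The matrix of expected numbers of visits to level `0` up to the hitting time of level `n`. -/
noncomputable def LUpTo (n : ℕ) : Matrix E E ℝ≥0∞ :=
  Matrix.of fun i j => ∫⁻ ω, occupation Z 0 j (hitTime Z n) ω ∂(P i)

variable [Fintype E] [DecidableEq E]

/-- The smallest modulus of an eigenvalue of `G`. -/
noncomputable def gamma : ℝ :=
  sInf ((fun l : ℂ => ‖l‖) '' spectrum ℂ ((G P Z).map (fun x : ℝ => (x : ℂ))))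

/-- `W` vanishes at `0`, is invertible at every `n ≥ 1`, and solves the two-sided upward exit
problem from every strip. -/
structure SolvesExitUp (W : ℕ → Matrix E E ℝ) : Prop where
  zero : W 0 = 0
  isUnit : ∀ n, 1 ≤ n → IsUnit (W n)
  exit : ∀ a b : ℕ, 0 < a → 0 < b → exitUp P Z a b = W b * (W (a + b))⁻¹

/-- The generating function of `W` is `(F(z) - I)⁻¹` on `(0, γ)`; this includes that the inverse
exists and that the series converges. -/
def HasScaleTransform (M : MarkovAdditiveChain E) (W : ℕ → Matrix E E ℝ) : Prop :=
  ∀ z : ℝ, 0 < z → z < gamma P Z →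
    IsUnit (M.F z - 1) ∧ HasSum (fun n : ℕ => z ^ n • W n) (M.F z - 1)⁻¹

end Matrices

end MarkovAdditiveChain

/-! Exit probabilities, passage matrices and occupation matrices are all potentials: iterates of a
taboo kernel, summed in `ℝ≥0∞`. There the first-step equation, minimality among supersolutions and
the strong Markov property need no integrability.

The scale function is the solution of `∑ₘ Aₘ W(x + m) = W(x) + 1_{x = 0} I` that vanishes at levels
`x ≤ 0`. Since jumps are at most `+1` and `A₁` is invertible, the equation determines `W(n + 1)`
from the lower levels. The same recursion shows that a matrix function vanishing at levels `≤ 0` and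
harmonic on `1, …, N - 1` is `W` times a constant on `[0, N]` (`eq_scale_mul`). The three explicit
formulas follow from this rigidity.

The exit matrix of the strip `(0, N)` has these properties and equals `I` at `N`, so `W(N)` is
invertible and the exit matrix is `W(k) W(N)⁻¹` (`exists_scale_inverse`). Next, `x ↦ G^(-x)` is
harmonic at every level. If `h(x)` counts the visits to level `0` from level `x`, then `h(x) =
G^(-x) h(0)` for `x ≤ 0` because the chain climbs one level at a time. Hence `G^(-x) h(0) - h(x)`
vanishes there and has source `I` at `0`, so it is `W` (`scale_eq_of_hasSum`). Stopping at level
`n`, or not stopping at all, gives the two occupation formulas.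

For the transform, `W(n) W(n + m)⁻¹ → G^m` as the lower barrier recedes. So `z^n W(n)` decays
geometrically once `z^m ‖G^(-m)‖ < 1/2`, which holds for large `m` when `z < γ` (`summable_scale`).
Summing the harmonicity equation against `z^x` is then a convolution and yields `(F(z) - I) ∑ z^n
W(n) = I`. -/

section Potential

/-! ### Potential theory of a taboo kernel on an abstract state space. -/

variable {S : Type*}

/-- One step of a chain with kernel `p`, killed on leaving a point of `D`, acting on functions. -/
noncomputable def tabooStep (p : S → S → ℝ≥0∞) (D : Set S) (f : S → ℝ≥0∞) : S → ℝ≥0∞ :=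
  Dᶜ.indicator fun s => ∑' t, p s t * f t

/-- The expected sum of `f` along the chain with kernel `p` up to and including the first
visit to `D`. -/
noncomputable def potential (p : S → S → ℝ≥0∞) (D : Set S) (f : S → ℝ≥0∞) (s : S) : ℝ≥0∞ :=
  ∑' n : ℕ, (tabooStep p D)^[n] f s

variable {p : S → S → ℝ≥0∞} {D D' C : Set S} {f g : S → ℝ≥0∞} {s : S}

theorem tabooStep_of_mem (hs : s ∈ D) : tabooStep p D f s = 0 := by
  simp [tabooStep, hs]

theorem tabooStep_of_notMem (hs : s ∉ D) : tabooStep p D f s = ∑' t, p s t * f t := by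
  simp [tabooStep, hs]

theorem tabooStep_mono (hD : D' ⊆ D) (h : ∀ t, f t ≤ g t) (s : S) :
    tabooStep p D f s ≤ tabooStep p D' g s := by
  by_cases hs : s ∈ D
  · simp [tabooStep_of_mem hs]
  · rw [tabooStep_of_notMem hs, tabooStep_of_notMem (fun h' => hs (hD h'))]
    exact ENNReal.tsum_le_tsum fun t => mul_le_mul_right (h t) _

theorem tabooStep_add : tabooStep p D (f + g) = tabooStep p D f + tabooStep p D g := by
  ext s
  by_cases hs : s ∈ D
  · simp [tabooStep_of_mem hs]
  · simp [tabooStep_of_notMem hs, mul_add, ENNReal.tsum_add]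

theorem tabooStep_tsum {ι : Type*} (F : ι → S → ℝ≥0∞) (s : S) :
    tabooStep p D (fun t => ∑' i, F i t) s = ∑' i, tabooStep p D (F i) s := by
  by_cases hs : s ∈ D
  · simp [tabooStep_of_mem hs]
  · simp only [tabooStep_of_notMem hs, ← ENNReal.tsum_mul_left]
    exact ENNReal.tsum_comm

theorem tabooStep_mul_const (c : ℝ≥0∞) (s : S) :
    tabooStep p D (fun t => f t * c) s = tabooStep p D f s * c := by
  by_cases hs : s ∈ D
  · simp [tabooStep_of_mem hs]
  · simp only [tabooStep_of_notMem hs, ← ENNReal.tsum_mul_right, mul_assoc]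

theorem potential_eq (p : S → S → ℝ≥0∞) (D : Set S) (f : S → ℝ≥0∞) (s : S) :
    potential p D f s = f s + tabooStep p D (potential p D f) s := by
  have h : tabooStep p D (potential p D f) s = ∑' n : ℕ, (tabooStep p D)^[n + 1] f s := by
    simp only [Function.iterate_succ_apply']
    exact tabooStep_tsum _ s
  rw [h, potential, tsum_eq_zero_add' ENNReal.summable]
  rfl

theorem potential_of_mem (hs : s ∈ D) : potential p D f s = f s := by
  rw [potential_eq, tabooStep_of_mem hs, add_zero]

theorem potential_of_notMem (hs : s ∉ D) :
    potential p D f s = f s + ∑' t, p s t * potential p D f t := by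
  rw [potential_eq, tabooStep_of_notMem hs]

/-- The potential of `f` is the least supersolution. -/
theorem potential_le (h : ∀ s, f s + tabooStep p D g s ≤ g s) (s : S) : potential p D f s ≤ g s := by
  -- Partial sums obey `S (n + 1) = f + T S n`, so induction keeps them below any supersolution.
  have key : ∀ n, (fun t => ∑ k ∈ Finset.range (n + 1), (tabooStep p D)^[k] f t) =
      f + tabooStep p D (fun t => ∑ k ∈ Finset.range n, (tabooStep p D)^[k] f t) := by
    intro n
    induction n with
    | zero =>
      ext t
      by_cases ht : t ∈ D <;> simp [tabooStep_of_mem, tabooStep_of_notMem, ht]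
    | succ n ih =>
      have h1 : (fun t => ∑ k ∈ Finset.range (n + 1), (tabooStep p D)^[k] f t) =
          (fun t => ∑ k ∈ Finset.range n, (tabooStep p D)^[k] f t) + (tabooStep p D)^[n] f := by
        ext t; simp [Finset.sum_range_succ]
      have h2 : (fun t => ∑ k ∈ Finset.range (n + 1 + 1), (tabooStep p D)^[k] f t) =
          (fun t => ∑ k ∈ Finset.range (n + 1), (tabooStep p D)^[k] f t)
            + (tabooStep p D)^[n + 1] f := by
        ext t; simp [Finset.sum_range_succ _ (n + 1)]
      rw [h2]
      conv_rhs => rw [h1]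
      rw [ih, tabooStep_add, Function.iterate_succ_apply', add_assoc]
  have bound : ∀ n s, ∑ k ∈ Finset.range n, (tabooStep p D)^[k] f s ≤ g s := by
    intro n
    induction n with
    | zero => simp
    | succ n ih =>
      intro s
      have := congrFun (key n) s
      simp only [Pi.add_apply] at this
      rw [this]
      exact (add_le_add_right (tabooStep_mono subset_rfl ih s) _).trans (h s)
  rw [potential, ENNReal.tsum_eq_iSup_nat]
  exact iSup_le fun n => bound n s

theorem potential_mono (hD : D' ⊆ D) (h : ∀ t, f t ≤ g t) (s : S) :
    potential p D f s ≤ potential p D' g s := by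
  refine potential_le (fun s => ?_) s
  rw [potential_eq p D' g s]
  exact add_le_add (h s) (tabooStep_mono hD (fun _ => le_rfl) s)

theorem potential_tsum {ι : Type*} (F : ι → S → ℝ≥0∞) (s : S) :
    potential p D (fun t => ∑' i, F i t) s = ∑' i, potential p D (F i) s := by
  have h : ∀ n s, (tabooStep p D)^[n] (fun t => ∑' i, F i t) s =
      ∑' i, (tabooStep p D)^[n] (F i) s := by
    intro n
    induction n with
    | zero => simp
    | succ n ih =>
      intro s
      simp only [Function.iterate_succ_apply']
      rw [← tabooStep_tsum, funext ih]
  simp only [potential, h]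
  exact ENNReal.tsum_comm

theorem potential_mul_const (c : ℝ≥0∞) (s : S) :
    potential p D (fun t => f t * c) s = potential p D f s * c := by
  have h : ∀ n s, (tabooStep p D)^[n] (fun t => f t * c) s = (tabooStep p D)^[n] f s * c := by
    intro n
    induction n with
    | zero => simp
    | succ n ih =>
      intro s
      simp only [Function.iterate_succ_apply']
      rw [← tabooStep_mul_const, funext ih]
  simp only [potential, h, ENNReal.tsum_mul_right]

open scoped Classical in
/-- The strong Markov property at the first visit to `C`. -/
theorem potential_eq_potential_union (p : S → S → ℝ≥0∞) (D C : Set S) (f : S → ℝ≥0∞) (s : S) :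
    potential p D f s =
      potential p (D ∪ C) (fun t => if t ∈ C then potential p D f t else f t) s := by
  set g : S → ℝ≥0∞ := fun t => if t ∈ C then potential p D f t else f t with hg
  have hle : ∀ s, potential p (D ∪ C) g s ≤ potential p D f s := by
    refine potential_le fun s => ?_
    by_cases hs : s ∈ C
    · simp [hg, hs, tabooStep_of_mem (Set.mem_union_right D hs)]
    · rw [potential_eq p D f s]
      simp only [hg, hs, if_false]
      exact add_le_add_right (tabooStep_mono Set.subset_union_left (fun _ => le_rfl) s) _
  -- The right side is a supersolution for `D` and `f`; at points of `C` this needs the inequality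
  -- `hle` just proved.
  refine le_antisymm (potential_le (fun s => ?_) s) (hle s)
  by_cases hs : s ∈ C
  · rw [potential_of_mem (Set.mem_union_right D hs)]
    simp only [hg, hs, if_true]
    conv_rhs => rw [potential_eq]
    exact add_le_add_right (tabooStep_mono subset_rfl hle s) _
  · rw [potential_eq p (D ∪ C) g s]
    simp only [hg, hs, if_false]
    refine add_le_add_right ?_ _
    by_cases hD : s ∈ D
    · simp [tabooStep_of_mem hD]
    · rw [tabooStep_of_notMem hD, tabooStep_of_notMem (by simp [hD, hs])]

/-- The potential only depends on data on a set which the chain cannot leave before `D`. -/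
theorem potential_congr {B : Set S} (hB : ∀ s ∈ B, s ∉ D → ∀ t ∉ B, p s t = 0)
    (hD : ∀ s ∈ B, s ∈ D ↔ s ∈ D') (hf : ∀ s ∈ B, f s = g s) (hs : s ∈ B) :
    potential p D f s = potential p D' g s := by
  have h : ∀ n, ∀ s ∈ B, (tabooStep p D)^[n] f s = (tabooStep p D')^[n] g s := by
    intro n
    induction n with
    | zero => simpa using hf
    | succ n ih =>
      intro s hs
      simp only [Function.iterate_succ_apply']
      by_cases hsD : s ∈ D
      · rw [tabooStep_of_mem hsD, tabooStep_of_mem ((hD s hs).1 hsD)]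
      · rw [tabooStep_of_notMem hsD, tabooStep_of_notMem (fun h => hsD ((hD s hs).2 h))]
        refine tsum_congr fun t => ?_
        by_cases ht : t ∈ B
        · rw [ih t ht]
        · rw [hB s hs hsD t ht, zero_mul, zero_mul]
  exact tsum_congr fun n => h n s hs

theorem potential_comp_equiv (e : S ≃ S) (he : ∀ s t, p (e s) (e t) = p s t) (s : S) :
    potential p D f (e s) = potential p (e ⁻¹' D) (f ∘ e) s := by
  have h : ∀ n s, (tabooStep p D)^[n] f (e s) = (tabooStep p (e ⁻¹' D))^[n] (f ∘ e) s := by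
    intro n
    induction n with
    | zero => simp
    | succ n ih =>
      intro s
      simp only [Function.iterate_succ_apply']
      by_cases hsD : e s ∈ D
      · rw [tabooStep_of_mem hsD, tabooStep_of_mem (by simpa using hsD)]
      · rw [tabooStep_of_notMem hsD, tabooStep_of_notMem (by simpa using hsD), ← e.tsum_eq]
        exact tsum_congr fun t => by rw [he, ih]
  exact tsum_congr fun n => h n s

/-- If the taboo sets decrease and every point eventually leaves the taboo set, unless it is in
`D'`, the potentials increase to the potential with taboo set `D'`. -/
theorem potential_eq_iSup [Countable S] {D : ℕ → Set S} (hD : Antitone D) (hD' : ∀ n, D' ⊆ D n)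
    (hev : ∀ s ∉ D', ∃ n, s ∉ D n) (s : S) :
    potential p D' f s = ⨆ n, potential p (D n) f s := by
  have hmono : Monotone fun n => potential p (D n) f :=
    fun m n hmn s => potential_mono (hD hmn) (fun _ => le_rfl) s
  refine le_antisymm (potential_le (g := fun s => ⨆ n, potential p (D n) f s) (fun s => ?_) s)
    (iSup_le fun n => potential_mono (hD' n) (fun _ => le_rfl) s)
  by_cases hs : s ∈ D'
  · rw [tabooStep_of_mem hs, add_zero]
    refine le_iSup_of_le 0 ?_
    rw [potential_eq]
    exact le_self_add
  · obtain ⟨N, hN⟩ := hev s hs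
    rw [tabooStep_of_notMem hs]
    -- Sums are read as integrals against counting measure, so that monotone convergence applies.
    let _ : MeasurableSpace S := ⊤
    have : ∑' t, p s t * ⨆ n, potential p (D n) f t =
        ⨆ n, ∑' t, p s t * potential p (D n) f t := by
      simp only [ENNReal.mul_iSup, ← lintegral_count]
      exact lintegral_iSup (f := fun n t => p s t * potential p (D n) f t)
        (fun n => measurable_from_top) (fun m n hmn t => mul_le_mul_right (hmono hmn t) _)
    rw [this, ENNReal.add_iSup]
    refine iSup_le fun n => le_iSup_of_le (max n N) ?_
    rw [potential_of_notMem (fun h => hN (hD (le_max_right n N) h))]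
    exact add_le_add_right
      (ENNReal.tsum_le_tsum fun t => mul_le_mul_right (hmono (le_max_left n N) t) _) _

end Potential

namespace MarkovAdditiveChain

/-! ### Hitting, exit and occupation quantities of the process as potentials. -/

section Link

variable {E : Type*} [Fintype E] (M : MarkovAdditiveChain E)

/-- The transition kernel of the chain on the states which are not killed. -/
noncomputable def kernel (s t : ℤ × E) : ℝ≥0∞ := ENNReal.ofReal (M.A (t.1 - s.1) s.2 t.2)

variable {M} {Ω : Type*} [MeasurableSpace Ω] {P : E → Measure Ω}
  {Z : ℕ → Ω → State E}

namespace IsRealization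

theorem measurableSet_path (hZ : M.IsRealization P Z) (n : ℕ) (c : ℕ → State E) :
    MeasurableSet {ω | ∀ k ≤ n, Z k ω = c k} := by
  simp only [Set.ofPred_forall]
  exact .iInter fun k => .iInter fun _ => hZ.measurable k _

theorem measure_path [∀ i, IsProbabilityMeasure (P i)] (hZ : M.IsRealization P Z) (i : E) (n : ℕ) (c : ℕ → State E) :
    P i {ω | ∀ k ≤ n + 1, Z k ω = c k} =
      P i {ω | ∀ k ≤ n, Z k ω = c k} * ENNReal.ofReal (M.trans (c n) (c (n + 1))) := by
  rw [← ofReal_measureReal (μ := P i) (s := {ω | ∀ k ≤ n + 1, Z k ω = c k}), hZ.markov,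
    ENNReal.ofReal_mul measureReal_nonneg, ofReal_measureReal]

theorem measurableSet_avoid (hZ : M.IsRealization P Z) (D : Set (State E)) (n : ℕ)
    (B : Set (State E)) : MeasurableSet {ω | (∀ k < n, Z k ω ∉ D) ∧ Z n ω ∈ B} := by
  have hm : ∀ k (C : Set (State E)), MeasurableSet {ω | Z k ω ∈ C} := by
    intro k C
    have : {ω | Z k ω ∈ C} = ⋃ c ∈ C, {ω | Z k ω = c} := by ext; simp
    rw [this]
    exact MeasurableSet.biUnion C.to_countable fun c _ => hZ.measurable k c
  have h : {ω | ∀ k < n, Z k ω ∉ D} = ⋂ k, ⋂ _ : k < n, {ω | Z k ω ∈ D}ᶜ := by ext; simp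
  have h' : MeasurableSet {ω | ∀ k < n, Z k ω ∉ D} := by
    rw [h]
    exact .iInter fun k => .iInter fun _ => (hm k D).compl
  exact h'.inter (hm n B)

variable [∀ i, IsProbabilityMeasure (P i)]

/-- The Markov property for events determined by the path up to time `n`. -/
theorem measure_step (hZ : M.IsRealization P Z) (i : E) (n : ℕ) (B : Set (Fin (n + 1) → State E))
    (s t : State E) :
    P i {ω | (fun k : Fin (n + 1) => Z k ω) ∈ B ∧ Z n ω = s ∧ Z (n + 1) ω = t} =
      P i {ω | (fun k : Fin (n + 1) => Z k ω) ∈ B ∧ Z n ω = s} *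
        ENNReal.ofReal (M.trans s t) := by
  -- Padding with `t` lets one infinite path describe the cylinders at times `n` and `n + 1`, as
  -- `markov` requires.
  let ext (c : Fin (n + 1) → State E) : ℕ → State E :=
    fun k => if h : k < n + 1 then c ⟨k, h⟩ else t
  have hext : ∀ (c : Fin (n + 1) → State E) (ω : Ω),
      (∀ k ≤ n, Z k ω = ext c k) ↔ (fun k : Fin (n + 1) => Z k ω) = c := by
    intro c ω
    constructor
    · intro h
      ext1 k
      have := h k (Nat.lt_succ_iff.1 k.2)
      simpa only [ext, k.2, dite_true] using this
    · rintro rfl k hk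
      simp only [ext, Nat.lt_succ_iff.2 hk, dite_true]
  set B' : Set (Fin (n + 1) → State E) := {c | c ∈ B ∧ c (Fin.last n) = s} with hB'
  have h1 : {ω | (fun k : Fin (n + 1) => Z k ω) ∈ B ∧ Z n ω = s ∧ Z (n + 1) ω = t} =
      ⋃ c ∈ B', {ω | ∀ k ≤ n + 1, Z k ω = ext c k} := by
    ext ω
    have hlast : ∀ c, (∀ k ≤ n + 1, Z k ω = ext c k) ↔
        (fun k : Fin (n + 1) => Z k ω) = c ∧ Z (n + 1) ω = t := by
      intro c
      rw [← hext]
      constructor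
      · intro h
        exact ⟨fun k hk => h k (by omega), by simpa [ext] using h (n + 1) le_rfl⟩
      · rintro ⟨h, h'⟩ k hk
        rcases Nat.lt_or_ge n k with hk' | hk'
        · obtain rfl : k = n + 1 := by omega
          simpa [ext] using h'
        · exact h k hk'
    simp only [Set.mem_iUnion, Set.mem_ofPred_eq, hlast, hB']
    constructor
    · rintro ⟨h, hs, ht⟩
      exact ⟨_, ⟨h, by simpa using hs⟩, rfl, ht⟩
    · rintro ⟨c, ⟨h, hs⟩, rfl, ht⟩
      exact ⟨h, by simpa using hs, ht⟩
  have h2 : {ω | (fun k : Fin (n + 1) => Z k ω) ∈ B ∧ Z n ω = s} =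
      ⋃ c ∈ B', {ω | ∀ k ≤ n, Z k ω = ext c k} := by
    ext ω
    simp only [Set.mem_iUnion, Set.mem_ofPred_eq, hext, hB']
    constructor
    · rintro ⟨h, hs⟩
      exact ⟨_, ⟨h, by simpa using hs⟩, rfl⟩
    · rintro ⟨c, ⟨h, hs⟩, rfl⟩
      exact ⟨h, by simpa using hs⟩
  have hdisj : B'.PairwiseDisjoint fun c => {ω | ∀ k ≤ n, Z k ω = ext c k} := by
    intro c _ c' _ hcc
    refine Set.disjoint_left.2 fun ω h h' => hcc ?_
    rw [← (hext c ω).1 h, ← (hext c' ω).1 h']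
  have hdisj' : B'.PairwiseDisjoint fun c => {ω | ∀ k ≤ n + 1, Z k ω = ext c k} :=
    hdisj.mono fun c ω h k hk => h k (hk.trans n.le_succ)
  rw [h1, h2, measure_biUnion B'.to_countable hdisj' (fun c _ => hZ.measurableSet_path _ _),
    measure_biUnion B'.to_countable hdisj (fun c _ => hZ.measurableSet_path _ _),
    ← ENNReal.tsum_mul_right]
  refine tsum_congr fun c => ?_
  rw [hZ.measure_path]
  have hc : c.1 (Fin.last n) = s := c.2.2
  congr 3
  · rw [← hc]
    simp [ext, Fin.last]
  · simp [ext]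

/-- The law of the chain at time `n`, on the event that it has avoided `D` before. -/
theorem measure_avoid_succ (hZ : M.IsRealization P Z) (i : E) (D : Set (State E)) (n : ℕ)
    (t : State E) :
    P i {ω | (∀ k < n + 1, Z k ω ∉ D) ∧ Z (n + 1) ω = t} =
      ∑' s, P i {ω | (∀ k < n, Z k ω ∉ D) ∧ Z n ω = s} *
        Dᶜ.indicator (fun s => ENNReal.ofReal (M.trans s t)) s := by
  have h1 : {ω | (∀ k < n + 1, Z k ω ∉ D) ∧ Z (n + 1) ω = t} =
      ⋃ s, {ω | (∀ k < n + 1, Z k ω ∉ D) ∧ Z n ω = s ∧ Z (n + 1) ω = t} := by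
    ext; simp
  have hms : ∀ s, MeasurableSet {ω | (∀ k < n + 1, Z k ω ∉ D) ∧ Z n ω = s ∧ Z (n + 1) ω = t} := by
    intro s
    have := (hZ.measurableSet_avoid D (n + 1) {t}).inter (hZ.measurable n s)
    convert this using 1
    ext; simp; tauto
  rw [h1, measure_iUnion _ hms]
  · refine tsum_congr fun s => ?_
    by_cases hs : s ∈ D
    · rw [Set.indicator_of_notMem (by simpa using hs), mul_zero]
      convert measure_empty (μ := P i)
      ext ω
      simp only [Set.mem_ofPred_eq, Set.mem_empty_iff_false, iff_false]
      rintro ⟨h, h', -⟩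
      exact h n (by omega) (h' ▸ hs)
    · rw [Set.indicator_of_mem (by simpa using hs)]
      have := hZ.measure_step i n {c | ∀ k, c k ∉ D} s t
      convert this using 2
      · ext ω
        simp only [Set.mem_ofPred_eq]
        refine and_congr_left fun _ => ⟨fun h k => h k k.2, fun h k hk => h ⟨k, hk⟩⟩
      · congr 1
        ext ω
        simp only [Set.mem_ofPred_eq]
        constructor
        · rintro ⟨h, h'⟩
          refine ⟨fun k => ?_, h'⟩
          rcases Nat.lt_or_ge k n with hk | hk
          · exact h k hk
          · rw [show (k : ℕ) = n by omega, h']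
            exact hs
        · rintro ⟨h, h'⟩
          exact ⟨fun k hk => h ⟨k, by omega⟩, h'⟩
  · intro s s' hss
    refine Set.disjoint_left.2 fun ω h h' => hss ?_
    rw [← h.2.1, ← h'.2.1]

/-- Forward evolution of the law is dual to backward iteration on functions: the last step of the
path is absorbed into `f`. The cemetery drops out because no living state is reached from it. -/
theorem tsum_measure_avoid (hZ : M.IsRealization P Z) (i : E) (D : Set (ℤ × E)) (n : ℕ)
    (f : ℤ × E → ℝ≥0∞) :
    ∑' t, P i {ω | (∀ k < n, Z k ω ∉ some '' D) ∧ Z n ω = some t} * f t =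
      (tabooStep M.kernel D)^[n] f (0, i) := by
  induction n generalizing f with
  | zero =>
    have h0 : ∀ t : ℤ × E, t ≠ (0, i) → P i {ω | Z 0 ω = some t} = 0 := by
      intro t ht
      have := (prob_compl_eq_zero_iff (hZ.measurable 0 (some (0, i)))).2 (hZ.initial i)
      refine measure_mono_null (fun ω h => ?_) this
      simp only [Set.mem_ofPred_eq] at h
      simpa [h] using ht
    simp only [Nat.not_lt_zero, IsEmpty.forall_iff, implies_true, true_and,
      Function.iterate_zero, id_eq]
    rw [tsum_eq_single (0, i) (fun t ht => by rw [h0 t ht, zero_mul]), hZ.initial, one_mul]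
  | succ n ih =>
    rw [Function.iterate_succ_apply, ← ih]
    have h : ∀ t : ℤ × E, P i {ω | (∀ k < n + 1, Z k ω ∉ some '' D) ∧ Z (n + 1) ω = some t} =
        ∑' s : ℤ × E, P i {ω | (∀ k < n, Z k ω ∉ some '' D) ∧ Z n ω = some s} *
          Dᶜ.indicator (fun s => M.kernel s t) s := by
      intro t
      rw [hZ.measure_avoid_succ, ← (Option.some_injective (ℤ × E)).tsum_eq]
      · refine tsum_congr fun s => ?_
        congr 1
        by_cases hs : s ∈ D
        · simp [hs]
        · simp [hs, kernel, trans]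
      · intro s hs
        rcases s with _ | s
        · exact absurd (by simp [trans]) hs
        · exact ⟨s, rfl⟩
    simp only [h, ← ENNReal.tsum_mul_right]
    rw [ENNReal.tsum_comm]
    refine tsum_congr fun s => ?_
    simp only [mul_assoc, ENNReal.tsum_mul_left]
    congr 1
    by_cases hs : s ∈ D
    · simp [hs, tabooStep_of_mem]
    · simp [hs, tabooStep_of_notMem]

theorem measure_avoid (hZ : M.IsRealization P Z) (i : E) (D B : Set (ℤ × E)) (n : ℕ) :
    P i {ω | (∀ k < n, Z k ω ∉ some '' D) ∧ Z n ω ∈ some '' B} =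
      (tabooStep M.kernel D)^[n] (B.indicator 1) (0, i) := by
  rw [← hZ.tsum_measure_avoid]
  have h1 : {ω | (∀ k < n, Z k ω ∉ some '' D) ∧ Z n ω ∈ some '' B} =
      ⋃ t ∈ B, {ω | (∀ k < n, Z k ω ∉ some '' D) ∧ Z n ω = some t} := by
    ext ω
    simp only [Set.mem_image, Set.mem_iUnion, Set.mem_ofPred_eq, exists_prop]
    constructor
    · rintro ⟨h, t, ht, h'⟩; exact ⟨t, ht, h, h'.symm⟩
    · rintro ⟨t, ht, h, h'⟩; exact ⟨h, t, ht, h'.symm⟩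
  rw [h1, measure_biUnion B.to_countable]
  · rw [tsum_subtype B (fun t => P i {ω | (∀ k < n, Z k ω ∉ some '' D) ∧ Z n ω = some t})]
    refine tsum_congr fun t => ?_
    by_cases ht : t ∈ B <;> simp [ht]
  · intro t _ t' _ htt
    refine Set.disjoint_left.2 fun ω h h' => htt ?_
    exact Option.some_injective _ (h.2.symm.trans h'.2)
  · intro t _
    exact hZ.measurableSet_avoid (some '' D) n {some t}

/-- With `B ⊆ D` the events are disjoint in `n`: only the first visit to `D` can count. -/
theorem measure_iUnion_avoid (hZ : M.IsRealization P Z) (i : E) {D B : Set (ℤ × E)} (hBD : B ⊆ D) :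
    P i (⋃ n, {ω | (∀ k < n, Z k ω ∉ some '' D) ∧ Z n ω ∈ some '' B}) =
      potential M.kernel D (B.indicator 1) (0, i) := by
  rw [measure_iUnion _ fun n => hZ.measurableSet_avoid _ n _]
  · exact tsum_congr fun n => hZ.measure_avoid i D B n
  · have : ∀ m n ω, m < n → ((∀ k < n, Z k ω ∉ some '' D) ∧ Z n ω ∈ some '' B) →
        ¬ ((∀ k < m, Z k ω ∉ some '' D) ∧ Z m ω ∈ some '' B) :=
      fun m n ω hmn h h' => h.1 m hmn (Set.image_mono hBD h'.2)
    intro m n hmn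
    refine Set.disjoint_left.2 fun ω h h' => ?_
    rcases lt_or_gt_of_ne hmn with hlt | hlt
    · exact this m n ω hlt h' h
    · exact this n m ω hlt h h'

end IsRealization

theorem hittingAfter_zero_eq_iff {Ω β : Type*} {u : ℕ → Ω → β} {s : Set β} {ω : Ω} {n : ℕ} :
    hittingAfter u s 0 ω = n ↔ (∀ k < n, u k ω ∉ s) ∧ u n ω ∈ s := by
  change _ = WithTop.some n ↔ _
  constructor
  · intro h
    refine ⟨fun k hk => notMem_of_lt_hittingAfter (by rw [h]; exact WithTop.coe_lt_coe.2 hk) (Nat.zero_le k), ?_⟩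
    have := hittingAfter_mem_set_of_ne_top (u := u) (s := s) (n := 0) (ω := ω) (by simp [h])
    rw [h] at this
    exact this
  · rintro ⟨h, h'⟩
    refine le_antisymm (hittingAfter_le_of_mem (Nat.zero_le n) h') ?_
    by_contra hlt
    obtain ⟨k, hk, hks⟩ := hittingAfter_lt_iff.1 (not_le.1 hlt)
    exact h k hk.2 hks

theorem coe_le_hittingAfter_zero_iff {Ω β : Type*} {u : ℕ → Ω → β} {s : Set β} {ω : Ω} {n : ℕ} :
    (n : WithTop ℕ) ≤ hittingAfter u s 0 ω ↔ ∀ k < n, u k ω ∉ s := by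
  change WithTop.some n ≤ _ ↔ _
  rw [← not_lt, hittingAfter_lt_iff]
  simp

end Link

end MarkovAdditiveChain

namespace MarkovAdditiveChain

section LinkMatrices

variable {E : Type*}

theorem setOf_level_eq (x : ℤ) :
    {s : Option (ℤ × E) | ∃ j, s = some (x, j)} = some '' {s : ℤ × E | s.1 = x} := by
  ext s
  constructor
  · rintro ⟨j, rfl⟩; exact ⟨(x, j), rfl, rfl⟩
  · rintro ⟨⟨y, j⟩, rfl, rfl⟩; exact ⟨j, rfl⟩

theorem setOf_ge_eq (x : ℤ) :
    {s : Option (ℤ × E) | ∃ y j, s = some (y, j) ∧ x ≤ y} = some '' {s : ℤ × E | x ≤ s.1} := by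
  ext s
  constructor
  · rintro ⟨y, j, rfl, h⟩; exact ⟨(y, j), h, rfl⟩
  · rintro ⟨⟨y, j⟩, h, rfl⟩; exact ⟨y, j, rfl, h⟩

theorem setOf_le_eq (x : ℤ) :
    {s : Option (ℤ × E) | ∃ y j, s = some (y, j) ∧ y ≤ x} = some '' {s : ℤ × E | s.1 ≤ x} := by
  ext s
  constructor
  · rintro ⟨y, j, rfl, h⟩; exact ⟨(y, j), h, rfl⟩
  · rintro ⟨⟨y, j⟩, h, rfl⟩; exact ⟨y, j, rfl, h⟩

variable [Fintype E] {M : MarkovAdditiveChain E} {Ω : Type*} [MeasurableSpace Ω]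
  {P : E → Measure Ω} [∀ i, IsProbabilityMeasure (P i)] {Z : ℕ → Ω → State E}

namespace IsRealization

theorem hitMatrix_apply (hZ : M.IsRealization P Z) (x : ℤ) (i j : E) :
    hitMatrix P Z x i j =
      (potential M.kernel {s | s.1 = x} (Set.indicator {(x, j)} 1) (0, i)).toReal := by
  rw [← hZ.measure_iUnion_avoid i (by simp)]
  simp only [hitMatrix, Matrix.of_apply, measureReal_def]
  congr 2
  ext ω
  simp only [phaseAt, hitTime, Set.mem_ofPred_eq, Set.mem_iUnion, hittingAfter_zero_eq_iff,
    setOf_level_eq]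
  refine exists_congr fun n => ?_
  constructor
  · rintro ⟨⟨h, ⟨s, hs, hs'⟩⟩, y, hy⟩
    rw [hy, Option.some_inj] at hs'
    subst hs'
    exact ⟨h, (y, j), by simpa using hs, hy.symm⟩
  · rintro ⟨h, ⟨s, hs, hs'⟩⟩
    obtain rfl : s = (x, j) := hs
    exact ⟨⟨h, ⟨_, rfl, hs'⟩⟩, x, hs'.symm⟩

theorem exitUp_apply (hZ : M.IsRealization P Z) (a b : ℕ) (ha : 0 < a) (i j : E) :
    exitUp P Z a b i j =
      (potential M.kernel {s | (a : ℤ) ≤ s.1 ∨ s.1 ≤ -b}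
        (Set.indicator {s | (a : ℤ) ≤ s.1 ∧ s.2 = j} 1) (0, i)).toReal := by
  have hBD : {s : ℤ × E | (a : ℤ) ≤ s.1 ∧ s.2 = j} ⊆ {s | (a : ℤ) ≤ s.1 ∨ s.1 ≤ -b} :=
    fun s hs => Or.inl hs.1
  rw [← hZ.measure_iUnion_avoid i hBD]
  simp only [exitUp, Matrix.of_apply, measureReal_def]
  congr 2
  ext ω
  simp only [phaseAt, upTime, downTime, Set.mem_inter_iff, Set.mem_ofPred_eq, Set.mem_iUnion,
    setOf_ge_eq, setOf_le_eq, hittingAfter_zero_eq_iff]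
  constructor
  · rintro ⟨hlt, n, ⟨h, hn⟩, x, hx⟩
    have hn' := hittingAfter_zero_eq_iff.2 ⟨h, hn⟩
    rw [hn'] at hlt
    have hdown : ∀ k ≤ n, Z k ω ∉ some '' {s : ℤ × E | s.1 ≤ -(b : ℤ)} := by
      intro k hk
      exact notMem_of_lt_hittingAfter ((WithTop.coe_le_coe.2 hk).trans_lt hlt) (Nat.zero_le k)
    refine ⟨n, fun k hk => ?_, ?_⟩
    · rintro ⟨s, hs | hs, hs'⟩
      · exact h k hk ⟨s, hs, hs'⟩
      · exact hdown k hk.le ⟨s, hs, hs'⟩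
    · obtain ⟨s, hs, hs'⟩ := hn
      rw [hx, Option.some_inj] at hs'
      subst hs'
      exact ⟨(x, j), ⟨hs, rfl⟩, hx.symm⟩
  · rintro ⟨n, h, s, hs, hs'⟩
    have h1 : (∀ k < n, Z k ω ∉ some '' {s : ℤ × E | (a : ℤ) ≤ s.1}) ∧
        Z n ω ∈ some '' {s : ℤ × E | (a : ℤ) ≤ s.1} := by
      refine ⟨fun k hk => ?_, ⟨s, hs.1, hs'⟩⟩
      rintro ⟨t, ht, ht'⟩
      exact h k hk ⟨t, Or.inl ht, ht'⟩
    refine ⟨?_, n, h1, s.1, ?_⟩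
    · rw [hittingAfter_zero_eq_iff.2 h1]
      by_contra hlt
      obtain ⟨k, hk, t, ht, ht'⟩ := hittingAfter_le_iff.1 (not_lt.1 hlt)
      rcases hk.2.lt_or_eq with hk | rfl
      · exact h k hk ⟨t, Or.inr ht, ht'⟩
      -- Both barriers cannot be met at the same time, because `0 < a`.
      · rw [← hs', Option.some_inj] at ht'
        subst ht'
        have h1 : (a : ℤ) ≤ t.1 := hs.1
        have h2 : t.1 ≤ -(b : ℤ) := ht
        omega
    · rw [← hs', ← hs.2]

theorem lintegral_tsum_avoid (hZ : M.IsRealization P Z) (i j : E) (x : ℤ) (D : Set (ℤ × E)) :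
    ∫⁻ ω, ∑' k : ℕ, {ω | (∀ l < k, Z l ω ∉ some '' D) ∧ Z k ω = some (x, j)}.indicator
      (1 : Ω → ℝ≥0∞) ω ∂(P i) =
      potential M.kernel D (Set.indicator {(x, j)} 1) (0, i) := by
  have h : ∀ k, {ω | (∀ l < k, Z l ω ∉ some '' D) ∧ Z k ω = some (x, j)} =
      {ω | (∀ l < k, Z l ω ∉ some '' D) ∧ Z k ω ∈ some '' {(x, j)}} := by
    intro k; simp [eq_comm]
  rw [lintegral_tsum]
  · refine tsum_congr fun k => ?_
    rw [← hZ.measure_avoid, h, lintegral_indicator_one (hZ.measurableSet_avoid _ k _)]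
  · intro k
    rw [h]
    exact ((measurable_one).indicator (hZ.measurableSet_avoid _ k _)).aemeasurable

theorem LUpTo_apply (hZ : M.IsRealization P Z) (n : ℕ) (i j : E) :
    LUpTo P Z n i j =
      potential M.kernel {s | s.1 = (n : ℤ)} (Set.indicator {(0, j)} 1) (0, i) := by
  rw [← hZ.lintegral_tsum_avoid]
  simp only [LUpTo, Matrix.of_apply, occupation, hitTime, coe_le_hittingAfter_zero_iff,
    setOf_level_eq]

theorem L_apply (hZ : M.IsRealization P Z) (i j : E) :
    L P Z i j = potential M.kernel ∅ (Set.indicator {(0, j)} 1) (0, i) := by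
  rw [← hZ.lintegral_tsum_avoid]
  simp [L, Matrix.of_apply, occupation]

end IsRealization

end LinkMatrices

/-! ### Spatial homogeneity, passage matrices and the first-step equation. -/

section Kernel

variable {E : Type*} [Fintype E] (M : MarkovAdditiveChain E)

theorem tsum_kernel_le_one (s : ℤ × E) : ∑' t, M.kernel s t ≤ 1 := by
  obtain ⟨x, i⟩ := s
  have h := M.hasSum_row i
  rw [← ((Equiv.addRight x).prodCongr (Equiv.refl E)).tsum_eq]
  have : ∀ t : ℤ × E, M.kernel (x, i) (((Equiv.addRight x).prodCongr (Equiv.refl E)) t) =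
      ENNReal.ofReal (M.A t.1 i t.2) := by
    intro t; simp [kernel]
  simp only [this]
  rw [← ENNReal.ofReal_tsum_of_nonneg (fun t => M.nonneg _ _ _) h.summable, h.tsum_eq]
  exact ENNReal.ofReal_le_one.2 (by linarith [M.killing_nonneg])

theorem kernel_eq_zero {s t : ℤ × E} (h : s.1 + 1 < t.1) : M.kernel s t = 0 := by
  simp [kernel, M.skipFree (t.1 - s.1) (by omega)]

theorem potential_le_one {D B : Set (ℤ × E)} (hBD : B ⊆ D) (s : ℤ × E) :
    potential M.kernel D (B.indicator 1) s ≤ 1 := by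
  refine potential_le (g := fun _ => 1) (fun s => ?_) s
  by_cases hs : s ∈ D
  · rw [tabooStep_of_mem hs, add_zero]
    exact Set.indicator_le_self' (by simp) s
  · rw [tabooStep_of_notMem hs, Set.indicator_of_notMem (fun h => hs (hBD h)), zero_add]
    simpa using M.tsum_kernel_le_one s

theorem potential_shift (D : Set (ℤ × E)) (f : ℤ × E → ℝ≥0∞) (c x : ℤ) (i : E) :
    potential M.kernel D f (x + c, i) =
      potential M.kernel {s | (s.1 + c, s.2) ∈ D} (fun s => f (s.1 + c, s.2)) (x, i) :=
  potential_comp_equiv ((Equiv.addRight c).prodCongr (Equiv.refl E))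
    (fun s t => by simp [kernel]) (x, i)

/-- The probability of being in phase `j` at the first visit to level `a`. -/
noncomputable def passageProb (a : ℤ) (j : E) (s : ℤ × E) : ℝ≥0∞ :=
  potential M.kernel {s | s.1 = a} (Set.indicator {(a, j)} 1) s

/-- The matrix of phases at the first visit to level `x`, starting from level `0`. -/
noncomputable def passage (x : ℤ) : Matrix E E ℝ :=
  Matrix.of fun i j => (M.passageProb x j (0, i)).toReal

theorem passageProb_le_one (a : ℤ) (j : E) (s : ℤ × E) : M.passageProb a j s ≤ 1 :=
  M.potential_le_one (by simp) s

theorem passageProb_shift (a : ℤ) (j : E) (x : ℤ) (i : E) :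
    M.passageProb a j (x, i) = M.passageProb (a - x) j (0, i) := by
  have := M.potential_shift {s | s.1 = a} (Set.indicator {(a, j)} 1) x 0 i
  rw [zero_add] at this
  rw [passageProb, this, passageProb]
  congr 1
  · ext s; simp [eq_sub_iff_add_eq]
  · ext s
    by_cases h : s = (a - x, j)
    · simp [h]
    · have h' : (s.1 + x, s.2) ∉ ({(a, j)} : Set (ℤ × E)) := by
        simp only [Set.mem_singleton_iff, Prod.ext_iff] at h ⊢
        exact fun h' => h ⟨by linarith [h'.1], h'.2⟩
      rw [Set.indicator_of_notMem h', Set.indicator_of_notMem (s := {(a - x, j)}) h]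

theorem passageProb_self (a : ℤ) (j : E) (i : E) :
    M.passageProb a j (a, i) = Set.indicator {i} 1 j := by
  rw [passageProb, potential_of_mem (by simp)]
  by_cases h : j = i
  · simp [h]
  · rw [Set.indicator_of_notMem, Set.indicator_of_notMem]
    · simpa using h
    · simpa using fun h' => h h'.symm

theorem toReal_passageProb (a : ℤ) (j : E) (x : ℤ) (i : E) :
    (M.passageProb a j (x, i)).toReal = M.passage (a - x) i j := by
  rw [passageProb_shift, passage, Matrix.of_apply]

open scoped Classical in
theorem potential_level (a : ℤ) (c : E → ℝ≥0∞) (s : ℤ × E) :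
    potential M.kernel {s | s.1 = a} (fun t => if t.1 = a then c t.2 else 0) s =
      ∑ k, M.passageProb a k s * c k := by
  have : (fun t : ℤ × E => if t.1 = a then c t.2 else 0) =
      fun t => ∑' k, Set.indicator {(a, k)} 1 t * c k := by
    ext ⟨x, i⟩
    rw [tsum_fintype]
    by_cases h : x = a
    · subst h
      rw [Finset.sum_eq_single i]
      · simp
      · intro k _ hk
        rw [Set.indicator_of_notMem (by simpa using hk.symm), zero_mul]
      · simp
    · simp [h]
  rw [this, potential_tsum, tsum_fintype]
  exact Finset.sum_congr rfl fun k _ => potential_mul_const _ _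

/-- From below level `a`, the chain has to visit level `a` before anything can happen above. -/
theorem potential_eq_sum_of_le {a x : ℤ} {D : Set (ℤ × E)} {f : ℤ × E → ℝ≥0∞}
    (hD : ∀ s ∈ D, a ≤ s.1) (hf : ∀ s, s.1 < a → f s = 0) (hx : x ≤ a) (i : E) :
    potential M.kernel D f (x, i) =
      ∑ k, M.passageProb a k (x, i) * potential M.kernel D f (a, k) := by
  classical
  rw [potential_eq_potential_union _ _ {s | s.1 = a}, ← potential_level]
  refine potential_congr (B := {s | s.1 ≤ a}) ?_ ?_ ?_ hx
  · intro s hs hsD t ht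
    apply M.kernel_eq_zero
    have h1 : s.1 ≤ a := hs
    have h2 : ¬ t.1 ≤ a := ht
    have h3 : s.1 ≠ a := fun h => hsD (Or.inr h)
    omega
  · intro s hs
    refine ⟨?_, fun h => Or.inr h⟩
    rintro (h | h)
    · exact le_antisymm hs (hD s h)
    · exact h
  · intro s hs
    have h1 : s.1 ≤ a := hs
    by_cases h : s.1 = a
    · subst h
      simp
    · simp [h, hf s (by omega)]

/-- Without a taboo set, nothing is collected before the first visit to level `a`, whichever side
the chain starts on; skip-freeness plays no role. -/
theorem potential_empty_eq_sum {a : ℤ} {f : ℤ × E → ℝ≥0∞} (hf : ∀ s, s.1 ≠ a → f s = 0)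
    (s : ℤ × E) :
    potential M.kernel ∅ f s = ∑ k, M.passageProb a k s * potential M.kernel ∅ f (a, k) := by
  classical
  rw [potential_eq_potential_union _ _ {s | s.1 = a}, ← potential_level, Set.empty_union]
  congr 1
  ext t
  by_cases h : t.1 = a
  · subst h
    simp
  · simp [h, hf t h]

theorem passage_zero [DecidableEq E] : M.passage 0 = 1 := by
  ext i j
  rw [passage, Matrix.of_apply, passageProb_self]
  by_cases h : j = i
  · subst h
    simp
  · rw [Set.indicator_of_notMem (by simpa using h), Matrix.one_apply_ne (Ne.symm h)]
    rfl

/-- An upward path to `a + b` cannot jump over level `a`, so passage matrices multiply. -/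
theorem passage_add {a b : ℤ} (ha : 0 ≤ a) (hb : 0 ≤ b) :
    M.passage (a + b) = M.passage a * M.passage b := by
  ext i j
  have h := M.potential_eq_sum_of_le (a := a) (x := 0) (D := {s | s.1 = a + b})
    (f := Set.indicator {(a + b, j)} 1) (by intro s hs; simp at hs; omega)
    (by
      intro s hs
      refine Set.indicator_of_notMem ?_ _
      rintro rfl
      simp at hs
      omega) ha i
  rw [Matrix.mul_apply]
  have h2 := M.toReal_passageProb (a + b) j
  simp only [passageProb] at h2
  have := congrArg ENNReal.toReal h
  rw [ENNReal.toReal_sum] at this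
  · simp only [ENNReal.toReal_mul, h2, toReal_passageProb] at this
    simpa using this
  · intro k _
    exact ENNReal.mul_ne_top ((M.passageProb_le_one _ _ _).trans_lt ENNReal.one_lt_top).ne
      ((M.passageProb_le_one _ _ _).trans_lt ENNReal.one_lt_top).ne

theorem passage_natCast [DecidableEq E] (n : ℕ) : M.passage n = M.passage 1 ^ n := by
  induction n with
  | zero => simp [passage_zero]
  | succ n ih => rw [Nat.cast_succ, M.passage_add (by omega) (by omega), ih, pow_succ]

/-- The matrices of finite values of a family of functions on `ℤ × E`. -/
noncomputable def toMat (h : E → ℤ × E → ℝ≥0∞) (x : ℤ) : Matrix E E ℝ :=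
  Matrix.of fun i j => (h j (x, i)).toReal

/-- Transfers the first-step equation with source `f` from `ℝ≥0∞` to real matrices; finiteness of
`h` is what makes the subtraction legitimate. -/
theorem hasSum_mul_toMat {h f : E → ℤ × E → ℝ≥0∞} {x : ℤ} (hfin : ∀ j s, h j s ≠ ⊤)
    (hstep : ∀ i j, h j (x, i) = f j (x, i) + ∑' t, M.kernel (x, i) t * h j t) :
    HasSum (fun m => M.A m * toMat h (x + m)) (toMat h x - toMat f x) := by
  refine Pi.hasSum.2 fun i => Pi.hasSum.2 fun j => ?_
  have hs := hstep i j
  have hne : ∑' t, M.kernel (x, i) t * h j t ≠ ⊤ :=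
    ne_top_of_le_ne_top (hfin j (x, i)) (hs ▸ le_add_self)
  have hfne : f j (x, i) ≠ ⊤ := ne_top_of_le_ne_top (hfin j (x, i)) (hs ▸ le_self_add)
  have h1 := ENNReal.hasSum_toReal hne
  rw [← ENNReal.tsum_toReal_eq (f := fun t => M.kernel (x, i) t * h j t)
    (fun t => ENNReal.mul_ne_top ENNReal.ofReal_ne_top (hfin j t))] at h1
  have h2 : (∑' t, M.kernel (x, i) t * h j t).toReal = (toMat h x - toMat f x) i j := by
    simp only [toMat, Matrix.sub_apply, Matrix.of_apply, hs]
    rw [ENNReal.toReal_add hfne hne, add_sub_cancel_left]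
  rw [h2] at h1
  have h3 := h1.prod_fiberwise (fun y => hasSum_fintype _)
  rw [← (Equiv.addLeft x).hasSum_iff] at h3
  convert h3 using 2 with m
  simp [Matrix.mul_apply, toMat, kernel, ENNReal.toReal_mul, ENNReal.toReal_ofReal (M.nonneg _ _ _)]

end Kernel

end MarkovAdditiveChain

namespace MarkovAdditiveChain

/-! ### The scale function and its rigidity. -/

section Scale

variable {E : Type*} [Fintype E] [DecidableEq E] (M : MarkovAdditiveChain E)

/-- The scale matrices, defined by solving the harmonicity equation upwards from level `0`. -/
noncomputable def scale : ℕ → Matrix E E ℝ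
  | 0 => 0
  | n + 1 => (M.A 1)⁻¹ * (scale n + (if n = 0 then 1 else 0) -
      ∑ k : Fin (n + 1), M.A (-(k : ℕ)) * scale (n - k))

@[simp] theorem scale_zero : M.scale 0 = 0 := by rw [scale]

variable {M}

/-- For a function vanishing at nonpositive levels the harmonicity sum is finite. -/
theorem hasSum_mul_of_support {f : ℤ → Matrix E E ℝ} (hf : ∀ x ≤ 0, f x = 0) (n : ℕ) :
    HasSum (fun m => M.A m * f (n + m))
      (M.A 1 * f (n + 1) + ∑ k ∈ Finset.range (n + 1), M.A (-(k : ℕ)) * f (n - k)) := by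
  have h : HasSum (fun k : ℕ => M.A (1 - k) * f (n + (1 - k)))
      (∑ k ∈ Finset.range (n + 2), M.A (1 - k) * f (n + (1 - k))) := by
    refine hasSum_sum_of_ne_finset_zero fun k hk => ?_
    rw [hf, mul_zero]
    have := Finset.mem_range.not.1 hk
    omega
  have hinj : Function.Injective fun k : ℕ => (1 - k : ℤ) := fun a b hab => by
    simp at hab; omega
  have h2 := (hinj.hasSum_iff (f := fun m => M.A m * f (n + m)) (fun m hm => by
    rw [M.skipFree, zero_mul]
    by_contra h'
    exact hm ⟨(1 - m).toNat, by simp; omega⟩)).1 h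
  convert h2 using 1
  rw [Finset.sum_range_succ' _ (n + 1), add_comm]
  congr 1
  · refine Finset.sum_congr rfl fun k _ => ?_
    push_cast
    congr 2 <;> ring_nf

/-- `Int.toNat` extends `scale` by zero below level `0`; the recursion then becomes harmonicity with
a unit source at `0`. -/
theorem hasSum_scale (hA : IsUnit (M.A 1)) (n : ℕ) :
    HasSum (fun m => M.A m * M.scale (n + m : ℤ).toNat)
      (M.scale n + if n = 0 then 1 else 0) := by
  have h := hasSum_mul_of_support (M := M) (f := fun x => M.scale x.toNat)
    (fun x hx => by simp [Int.toNat_of_nonpos hx]) n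
  convert h using 1
  have h1 : ((n : ℤ) + 1).toNat = n + 1 := by omega
  have h2 : ∀ k : ℕ, ((n : ℤ) - k).toNat = n - k := by intro k; omega
  simp only [h1, h2]
  rw [scale, ← mul_assoc, Matrix.mul_nonsing_inv _ ((Matrix.isUnit_iff_isUnit_det _).1 hA), one_mul,
    Finset.sum_range (fun k => M.A (-(k : ℕ)) * M.scale (n - k)), sub_add_cancel]

/-- A function which vanishes at nonpositive levels and is harmonic at the levels between `0` and
`n` is a multiple of the scale function. -/
theorem eq_scale_mul (hA : IsUnit (M.A 1)) {f : ℤ → Matrix E E ℝ} {C : Matrix E E ℝ} {n : ℕ}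
    (hf : ∀ x ≤ 0, f x = 0)
    (hsum : ∀ k : ℕ, k < n → HasSum (fun m => M.A m * f (k + m)) (f k + if k = 0 then C else 0)) :
    ∀ k : ℕ, k ≤ n → f k = M.scale k * C := by
  intro k
  induction k using Nat.strong_induction_on with
  | _ k ih =>
    intro hk
    rcases k with _ | k
    · simp [hf]
    -- The harmonic sums of `f` and of `scale` agree in all lower terms by induction, leaving the
    -- terms with `A 1`, which cancels.
    have h1 := (hsum k (by omega)).unique (hasSum_mul_of_support hf k)
    have h2 := (hasSum_scale hA k).unique (hasSum_mul_of_support (M := M)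
      (f := fun x => M.scale x.toNat) (fun x hx => by simp [Int.toNat_of_nonpos hx]) k)
    have h3 := congrArg (· * C) h2
    simp only [add_mul, Finset.sum_mul, mul_assoc] at h3
    have h4 : ∑ k_1 ∈ Finset.range (k + 1), M.A (-(k_1 : ℕ)) * f (k - k_1) =
        ∑ x ∈ Finset.range (k + 1), M.A (-(x : ℕ)) * (M.scale ((k : ℤ) - x).toNat * C) := by
      refine Finset.sum_congr rfl fun l hl => ?_
      have hl := Finset.mem_range.1 hl
      have := ih (k - l) (by omega) (by omega)
      rw [Nat.cast_sub (by omega)] at this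
      rw [this]
      congr 3
      omega
    rw [h4, ih k (by omega) (by omega)] at h1
    have h5 : (if k = 0 then C else 0) = (if k = 0 then (1 : Matrix E E ℝ) else 0) * C := by
      split_ifs <;> simp
    rw [h5] at h1
    have h6 := h1.symm.trans h3
    have h7 : ((k : ℤ) + 1).toNat = k + 1 := by omega
    rw [h7, add_right_cancel_iff] at h6
    push_cast
    exact hA.mul_left_cancel h6

end Scale

/-! ### Finiteness of the occupation before level `n`. -/

section Fluctuation

variable {E : Type*} [Fintype E] [DecidableEq E] {M : MarkovAdditiveChain E}

/-- An invertible matrix has no zero row, and there are finitely many rows. -/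
theorem exists_pos_le_sum_A_one (hA : IsUnit (M.A 1)) :
    ∃ δ : ℝ, 0 < δ ∧ δ ≤ 1 ∧ ∀ i, δ ≤ ∑ j, M.A 1 i j := by
  rcases isEmpty_or_nonempty E with hE | hE
  · exact ⟨1, one_pos, le_rfl, fun i => hE.elim i⟩
  have hpos : ∀ i, 0 < ∑ j, M.A 1 i j := by
    intro i
    refine (Finset.sum_nonneg fun j _ => M.nonneg 1 i j).lt_of_ne fun h => ?_
    have h0 : ∀ j, M.A 1 i j = 0 := fun j =>
      (Finset.sum_eq_zero_iff_of_nonneg (fun j _ => M.nonneg 1 i j)).1 h.symm j (Finset.mem_univ j)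
    have hdet := (Matrix.isUnit_iff_isUnit_det _).1 hA
    rw [Matrix.det_eq_zero_of_row_eq_zero i h0] at hdet
    exact not_isUnit_zero hdet
  obtain ⟨i₀, -, h₀⟩ := Finset.exists_min_image Finset.univ (fun i => ∑ j, M.A 1 i j)
    Finset.univ_nonempty
  exact ⟨min 1 (∑ j, M.A 1 i₀ j), lt_min one_pos (hpos i₀), min_le_left _ _,
    fun i => (min_le_right _ _).trans (h₀ i (Finset.mem_univ i))⟩

/-- The expected number of visits to level `0` before level `n` is bounded. -/
theorem exists_potential_le (hA : IsUnit (M.A 1)) {n : ℕ} (hn : 1 ≤ n) :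
    ∃ c : ℝ≥0∞, c ≠ ⊤ ∧ ∀ j s,
      potential M.kernel {s | s.1 = (n : ℤ)} (Set.indicator {(0, j)} 1) s ≤ c := by
  obtain ⟨δ, hδ, hδ1, hrow⟩ := exists_pos_le_sum_A_one hA
  set d : ℝ≥0∞ := ENNReal.ofReal δ with hd
  have hd0 : d ≠ 0 := by simpa [hd] using hδ
  have hd1 : d ≤ 1 := ENNReal.ofReal_le_one.2 hδ1
  have hdn : d ^ n ≠ 0 := pow_ne_zero _ hd0
  have hdn' : d ^ n ≠ ⊤ := ENNReal.pow_ne_top ENNReal.ofReal_ne_top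
  -- `ρ` bounds from below the chance of climbing to `n` by unit steps before visiting `0`.
  let ρ : ℤ × E → ℝ≥0∞ := fun s => if 0 < s.1 ∧ s.1 ≤ n then d ^ (n - s.1).toNat else 0
  have hρ1 : ∀ s, ρ s ≤ 1 := by
    intro s
    simp only [ρ]
    split_ifs
    · exact pow_le_one₀ (zero_le) hd1
    · exact zero_le
  have hup : ∀ x : ℤ, 0 ≤ x → x < n → ∀ i, d ^ (n - x).toNat ≤ ∑' t, M.kernel (x, i) t * ρ t := by
    intro x hx hxn i
    have hinj : Function.Injective fun j : E => ((x + 1, j) : ℤ × E) := fun a b h => by simpa using h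
    have h1 := ENNReal.tsum_comp_le_tsum_of_injective hinj (fun t => M.kernel (x, i) t * ρ t)
    refine le_trans ?_ h1
    have h2 : ∀ j, M.kernel (x, i) (x + 1, j) * ρ (x + 1, j) =
        ENNReal.ofReal (M.A 1 i j) * d ^ (n - (x + 1)).toNat := by
      intro j
      simp only [ρ, kernel]
      rw [if_pos (by constructor <;> simp <;> omega), add_sub_cancel_left]
    simp only [h2, ENNReal.tsum_mul_right]
    rw [show (n - x).toNat = (n - (x + 1)).toNat + 1 by omega, pow_succ', tsum_fintype,
      ← ENNReal.ofReal_sum_of_nonneg (fun j _ => M.nonneg 1 i j)]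
    exact mul_le_mul_left (ENNReal.ofReal_le_ofReal (hrow i)) _
  have hsum : ∀ s, (∑' t, M.kernel s t * (1 - ρ t)) + ∑' t, M.kernel s t * ρ t ≤ 1 := by
    intro s
    rw [← ENNReal.tsum_add]
    refine le_trans (le_of_eq (tsum_congr fun t => ?_)) (M.tsum_kernel_le_one s)
    rw [← mul_add, tsub_add_cancel_of_le (hρ1 t), mul_one]
  refine ⟨(d ^ n)⁻¹, ENNReal.inv_ne_top.2 hdn, fun j s => ?_⟩
  -- Off level `0` the mean of `1 - ρ` does not increase in a step; from level `0` it drops by at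
  -- least `d ^ n`, which after scaling pays for one visit.
  refine (potential_le (g := fun s => (1 - ρ s) * (d ^ n)⁻¹) (fun s => ?_) s).trans
    (mul_le_of_le_one_left zero_le tsub_le_self)
  obtain ⟨x, i⟩ := s
  have hne : ∀ y : ℤ, y ≠ 0 → ∀ i, Set.indicator {((0 : ℤ), j)} (1 : ℤ × E → ℝ≥0∞) (y, i) = 0 := by
    intro y hy i
    exact Set.indicator_of_notMem (by simp [hy]) _
  by_cases hxn : x = n
  · rw [tabooStep_of_mem (by simpa using hxn), hne x (by omega), zero_add]
    exact zero_le
  rw [tabooStep_mul_const, tabooStep_of_notMem (by simpa using hxn)]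
  have hs := hsum (x, i)
  by_cases hx0 : x = 0
  · subst hx0
    have h1 := hup 0 le_rfl (by omega) i
    rw [sub_zero, Int.toNat_natCast] at h1
    have hρ0 : ρ (0, i) = 0 := by simp [ρ]
    rw [hρ0, tsub_zero, one_mul]
    have h2 : Set.indicator {((0 : ℤ), j)} (1 : ℤ × E → ℝ≥0∞) (0, i) ≤ d ^ n * (d ^ n)⁻¹ := by
      rw [ENNReal.mul_inv_cancel hdn hdn']
      exact Set.indicator_le_self' (by simp) _
    refine (add_le_add_left h2 _).trans ?_
    rw [← add_mul]
    refine mul_le_of_le_one_left zero_le ?_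
    rw [add_comm]
    exact (add_le_add_right h1 _).trans hs
  · rw [hne x hx0, zero_add]
    gcongr
    by_cases hx : 0 < x ∧ x < n
    · have h1 := hup x hx.1.le hx.2 i
      have hρx : ρ (x, i) = d ^ (n - x).toNat := by simp [ρ, hx.1, hx.2.le]
      rw [hρx]
      exact ENNReal.le_sub_of_add_le_right (ENNReal.pow_ne_top ENNReal.ofReal_ne_top)
        ((add_le_add_right h1 _).trans hs)
    · have hρx : ρ (x, i) = 0 := by
        simp only [ρ]
        rw [if_neg]
        simp only [not_and, not_le, not_lt] at hx ⊢
        omega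
      rw [hρx, tsub_zero]
      exact le_self_add.trans hs

end Fluctuation

end MarkovAdditiveChain

namespace MarkovAdditiveChain

/-! ### The matrix `G`, and the occupation and exit formulas. -/

section Fundamental

variable {E : Type*} [DecidableEq E]

theorem toMat_indicator_level_zero (k : ℕ) :
    toMat (fun j : E => Set.indicator {((0 : ℤ), j)} (1 : ℤ × E → ℝ≥0∞)) k =
      if k = 0 then 1 else 0 := by
  ext i j
  simp only [toMat, Matrix.of_apply]
  by_cases hk : k = 0
  · subst hk
    by_cases hij : i = j
    · subst hij
      simp
    · simp [hij]
  · simp [hk]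

variable [Fintype E] {M : MarkovAdditiveChain E}

/-- After a first jump `m ≤ 1` the chain still has `1 - m` levels to climb, one at a time. The
truncation by `toNat` only affects `m > 1`, where `A m = 0`. -/
theorem hasSum_mul_passage (M : MarkovAdditiveChain E) :
    HasSum (fun m : ℤ => M.A m * M.passage 1 ^ (1 - m).toNat) (M.passage 1) := by
  have h := M.hasSum_mul_toMat (h := fun j => M.passageProb 1 j)
    (f := fun j => Set.indicator {(1, j)} 1) (x := 0)
    (fun j s => ((M.passageProb_le_one 1 j s).trans_lt ENNReal.one_lt_top).ne)
    (fun i j => potential_of_notMem (by simp))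
  have h1 : toMat (fun j : E => Set.indicator {((1 : ℤ), j)} (1 : ℤ × E → ℝ≥0∞)) 0 = 0 := by
    ext i j; simp [toMat]
  have h2 : ∀ x, toMat (fun j => M.passageProb 1 j) x = M.passage (1 - x) := by
    intro x; ext i j; exact M.toReal_passageProb 1 j x i
  rw [h1, sub_zero, h2, sub_zero] at h
  convert h using 2 with m
  by_cases hm : m ≤ 1
  · rw [← passage_natCast, Int.toNat_of_nonneg (by omega), zero_add, h2]
  · rw [M.skipFree m (by omega), zero_mul, zero_mul]

/-- If `G v = 0`, every term of the equation for `G` with `m ≤ 0` kills `v`, leaving `A₁ v = 0`. -/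
theorem isUnit_passage_one (hA : IsUnit (M.A 1)) : IsUnit (M.passage 1) := by
  rw [← Matrix.mulVec_injective_iff_isUnit, ← Matrix.coe_mulVecLin, ← LinearMap.ker_eq_bot,
    LinearMap.ker_eq_bot']
  intro v hv
  rw [Matrix.mulVecLin_apply] at hv
  set V : Matrix E E ℝ := Matrix.of fun i _ => v i with hV
  have hGV : M.passage 1 * V = 0 := by
    ext i j
    exact congrFun hv i
  have h := M.hasSum_mul_passage.mul_right V
  rw [hGV] at h
  have h1 := hasSum_single (f := fun m : ℤ => M.A m * M.passage 1 ^ (1 - m).toNat * V) 1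
    (fun m hm => by
      rcases lt_or_gt_of_ne hm with hm | hm
      · obtain ⟨k, hk⟩ : ∃ k : ℕ, (1 - m).toNat = k + 1 := ⟨(-m).toNat, by omega⟩
        rw [hk, pow_succ, mul_assoc, mul_assoc, hGV, mul_zero, mul_zero]
      · rw [M.skipFree m (by omega), zero_mul, zero_mul])
  have h2 : M.A 1 * V = M.A 1 * 0 := by simpa using h1.unique h
  have h3 := hA.mul_left_cancel h2
  ext i
  exact congrFun (congrFun h3 i) i

variable (hA : IsUnit (M.A 1))
include hA

theorem hasSum_mul_passage_zpow (x : ℤ) :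
    HasSum (fun m : ℤ => M.A m * M.passage 1 ^ (-(x + m))) (M.passage 1 ^ (-x)) := by
  have hdet := (Matrix.isUnit_iff_isUnit_det _).1 (isUnit_passage_one hA)
  have h := M.hasSum_mul_passage.mul_right (M.passage 1 ^ (-x - 1))
  have h1 : M.passage 1 * M.passage 1 ^ (-x - 1) = M.passage 1 ^ (-x) := by
    rw [← Matrix.zpow_one_add hdet]
    congr 1
    ring
  rw [h1] at h
  suffices h2 : ∀ m : ℤ, M.A m * M.passage 1 ^ (-(x + m)) =
      M.A m * M.passage 1 ^ (1 - m).toNat * M.passage 1 ^ (-x - 1) by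
    simpa only [h2] using h
  intro m
  by_cases hm : m ≤ 1
  · rw [mul_assoc, ← zpow_natCast, ← Matrix.zpow_add hdet, Int.toNat_of_nonneg (by omega)]
    congr 2
    ring
  · rw [M.skipFree m (by omega), zero_mul, zero_mul, zero_mul]

/-- If the matrices `h` count visits to level `0` and are `G ^ (-x) * h 0` below level `0`, then
`G ^ (-x) * h 0 - h x` is the scale function up to level `n`. -/
theorem scale_eq_of_hasSum {h : ℤ → Matrix E E ℝ} {n : ℕ}
    (hneg : ∀ x ≤ 0, h x = M.passage 1 ^ (-x) * h 0)
    (hsum : ∀ k : ℕ, k < n →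
      HasSum (fun m => M.A m * h (k + m)) (h k - if k = 0 then 1 else 0)) :
    M.scale n = M.passage 1 ^ (-(n : ℤ)) * h 0 - h n := by
  have := eq_scale_mul hA (f := fun x => M.passage 1 ^ (-x) * h 0 - h x) (C := 1) (n := n)
    (fun x hx => by rw [hneg x hx, sub_self]) (fun k hk => ?_) n le_rfl
  · rw [this, mul_one]
  · have h1 := ((hasSum_mul_passage_zpow hA k).mul_right (h 0)).sub (hsum k hk)
    rw [sub_add]
    simpa only [mul_sub, mul_assoc] using h1

theorem scale_eq_passage_mul {n : ℕ} (hn : 1 ≤ n) :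
    M.scale n = M.passage 1 ^ (-(n : ℤ)) *
      toMat (fun j => potential M.kernel {s | s.1 = (n : ℤ)} (Set.indicator {(0, j)} 1)) 0 := by
  obtain ⟨c, hc, hle⟩ := exists_potential_le hA hn
  set h : E → ℤ × E → ℝ≥0∞ :=
    fun j => potential M.kernel {s | s.1 = (n : ℤ)} (Set.indicator {(0, j)} 1) with hh
  have hfin : ∀ j s, h j s ≠ ⊤ := fun j s => ne_top_of_le_ne_top hc (hle j s)
  -- Counting stops at level `n ≠ 0`, so the correction term `h n` disappears.
  have hn0 : toMat h n = 0 := by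
    ext i j
    simp only [toMat, hh, Matrix.of_apply]
    rw [potential_of_mem (by simp), Set.indicator_of_notMem (by simp; omega)]
    rfl
  have := scale_eq_of_hasSum hA (h := toMat h) (n := n) ?_ ?_
  · rw [this, hn0, sub_zero]
  · intro x hx
    obtain ⟨m, rfl⟩ : ∃ m : ℕ, x = -m := ⟨x.natAbs, by omega⟩
    ext i j
    rw [neg_neg, zpow_natCast, ← passage_natCast, Matrix.mul_apply]
    simp only [toMat, Matrix.of_apply]
    rw [hh]
    simp only
    rw [M.potential_eq_sum_of_le (a := 0) (by intro s hs; simp at hs; omega)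
      (fun s hs => Set.indicator_of_notMem (by rintro rfl; simp at hs) _) hx,
      ENNReal.toReal_sum]
    · simp only [ENNReal.toReal_mul, toReal_passageProb]
      simp
    · intro k _
      exact ENNReal.mul_ne_top ((M.passageProb_le_one _ _ _).trans_lt ENNReal.one_lt_top).ne
        (hfin j _)
  · intro k hk
    have h1 := M.hasSum_mul_toMat (h := h) (f := fun j => Set.indicator {(0, j)} 1) (x := k) hfin
      (fun i j => potential_of_notMem (by simp; omega))
    rwa [toMat_indicator_level_zero] at h1

/-- Here the strong Markov property at the first visit to level `0` gives `h(x)` as a passage matrix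
times `h(0)` also above `0`. -/
theorem scale_eq_sub_mul
    (hfin : ∀ i j, potential M.kernel ∅ (Set.indicator {(0, j)} 1) (0, i) ≠ ⊤) (n : ℕ) :
    M.scale n = (M.passage 1 ^ (-(n : ℤ)) - M.passage (-n)) *
      toMat (fun j => potential M.kernel ∅ (Set.indicator {(0, j)} 1)) 0 := by
  set h : E → ℤ × E → ℝ≥0∞ :=
    fun j => potential M.kernel ∅ (Set.indicator {(0, j)} 1) with hh
  have hdec : ∀ j s, h j s = ∑ k, M.passageProb 0 k s * h j (0, k) := fun j s =>
    M.potential_empty_eq_sum (fun s hs => Set.indicator_of_notMem (by rintro rfl; simp at hs) _) s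
  have hne : ∀ j s k, M.passageProb 0 k s * h j (0, k) ≠ ⊤ := fun j s k =>
    ENNReal.mul_ne_top ((M.passageProb_le_one _ _ _).trans_lt ENNReal.one_lt_top).ne (hfin k j)
  have hfin' : ∀ j s, h j s ≠ ⊤ := by
    intro j s
    rw [hdec]
    exact ENNReal.sum_ne_top.2 fun k _ => hne j s k
  have hpass : ∀ x, toMat h x = M.passage (-x) * toMat h 0 := by
    intro x
    ext i j
    rw [Matrix.mul_apply]
    simp only [toMat, Matrix.of_apply]
    rw [hdec, ENNReal.toReal_sum fun k _ => hne j _ k]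
    simp only [ENNReal.toReal_mul, toReal_passageProb, zero_sub]
  have := scale_eq_of_hasSum hA (h := toMat h) (n := n) ?_ ?_
  · rw [this, hpass n, sub_mul]
  · intro x hx
    obtain ⟨m, rfl⟩ : ∃ m : ℕ, x = -m := ⟨x.natAbs, by omega⟩
    rw [hpass, neg_neg, zpow_natCast, ← passage_natCast]
  · intro k hk
    have h1 := M.hasSum_mul_toMat (h := h) (f := fun j => Set.indicator {(0, j)} 1) (x := k) hfin'
      (fun i j => potential_of_notMem (by simp))
    rwa [toMat_indicator_level_zero] at h1

/-- The two-sided exit problem upwards, for the strip between the levels `0` and `N`. -/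
theorem exists_scale_inverse {N : ℕ} (hN : 1 ≤ N) :
    IsUnit (M.scale N) ∧ ∀ k : ℕ, k ≤ N →
      toMat (fun j => potential M.kernel {s | (N : ℤ) ≤ s.1 ∨ s.1 ≤ 0}
        (Set.indicator {s | (N : ℤ) ≤ s.1 ∧ s.2 = j} 1)) k = M.scale k * (M.scale N)⁻¹ := by
  set h : E → ℤ × E → ℝ≥0∞ := fun j => potential M.kernel {s | (N : ℤ) ≤ s.1 ∨ s.1 ≤ 0}
        (Set.indicator {s | (N : ℤ) ≤ s.1 ∧ s.2 = j} 1) with hh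
  have hfin : ∀ j s, h j s ≠ ⊤ := fun j s =>
    ((M.potential_le_one (fun t ht => Or.inl ht.1) s).trans_lt ENNReal.one_lt_top).ne
  have h0 : ∀ x ≤ 0, toMat h x = 0 := by
    intro x hx
    ext i j
    simp only [toMat, hh, Matrix.of_apply]
    rw [potential_of_mem (by right; exact hx), Set.indicator_of_notMem (by simp; omega)]
    rfl
  have hN1 : toMat h N = 1 := by
    ext i j
    simp only [toMat, hh, Matrix.of_apply]
    rw [potential_of_mem (by left; exact le_rfl)]
    by_cases hij : i = j
    · subst hij
      simp
    · simp [hij]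
  -- At level `0` only the jump `m = 1` contributes to the harmonic sum, which dictates `C`.
  have key := eq_scale_mul hA (f := toMat h) (C := M.A 1 * toMat h 1) (n := N) h0 (fun k hk => ?_)
  · have hunit : M.scale N * (M.A 1 * toMat h 1) = 1 := by rw [← key N le_rfl, hN1]
    refine ⟨IsUnit.of_mul_eq_one _ hunit, fun k hk => ?_⟩
    rw [key k hk, Matrix.inv_eq_right_inv hunit]
  · rcases k with _ | k
    · have := hasSum_mul_of_support (M := M) h0 0
      simpa [h0] using this
    · have h1 := M.hasSum_mul_toMat (h := h)
        (f := fun j => Set.indicator {s | (N : ℤ) ≤ s.1 ∧ s.2 = j} 1) (x := (k + 1 : ℕ)) hfin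
        (fun i j => potential_of_notMem (by simp; omega))
      convert h1 using 1
      rw [if_neg (by omega), add_zero]
      symm
      rw [sub_eq_self]
      ext i j
      simp only [toMat, Matrix.of_apply]
      rw [Set.indicator_of_notMem (by simp; omega)]
      rfl

end Fundamental

end MarkovAdditiveChain

/-! ### Geometric decay and spectral estimates. -/

theorem summable_of_shift_le_half {a : ℕ → ℝ} (ha : ∀ n, 0 ≤ a n) {m n₀ : ℕ}
    (h : ∀ n, n₀ ≤ n → a (n + m) ≤ a n / 2) : Summable a := by
  rw [← summable_nat_add_iff n₀]
  set b : ℕ → ℝ := fun n => a (n + n₀) with hb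
  have hb0 : ∀ n, 0 ≤ b n := fun n => ha _
  -- A partial sum is at most the first `m` terms plus half of itself.
  refine summable_of_sum_range_le (c := 2 * ∑ k ∈ Finset.range m, b k) hb0 fun N => ?_
  have h1 : ∑ k ∈ Finset.range N, b k ≤ ∑ k ∈ Finset.range (m + N), b k :=
    Finset.sum_le_sum_of_subset_of_nonneg (Finset.range_mono (by omega)) fun k _ _ => hb0 k
  have h2 : ∑ k ∈ Finset.range N, b (m + k) ≤ ∑ k ∈ Finset.range N, b k / 2 := by
    refine Finset.sum_le_sum fun k _ => ?_
    have := h (k + n₀) (by omega)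
    simp only [hb]
    rwa [show m + k + n₀ = k + n₀ + m by omega]
  rw [Finset.sum_range_add] at h1
  rw [← Finset.sum_div] at h2
  linarith

/-- Gelfand's formula. -/
theorem eventually_norm_pow_le_of_spectralRadius_lt {A : Type*} [NormedRing A] [NormedAlgebra ℂ A]
    [CompleteSpace A] {a : A} {r : NNReal} (h : spectralRadius ℂ a < r) :
    ∀ᶠ n : ℕ in Filter.atTop, ‖a ^ n‖ ≤ (r : ℝ) ^ n := by
  filter_upwards [(spectrum.pow_nnnorm_pow_one_div_tendsto_nhds_spectralRadius a).eventually_lt_const h,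
    Filter.eventually_gt_atTop 0] with n hn hn0
  have h1 : (‖a ^ n‖₊ : ℝ≥0∞) ≤ (r : ℝ≥0∞) ^ n := by
    have := ENNReal.rpow_le_rpow hn.le (Nat.cast_nonneg (α := ℝ) n)
    rwa [← ENNReal.rpow_mul, one_div_mul_cancel (by positivity), ENNReal.rpow_one,
      ENNReal.rpow_natCast] at this
  exact_mod_cast h1

open scoped Matrix.Norms.Operator

theorem Matrix.norm_map_ofReal {n : Type*} [Fintype n] (A : Matrix n n ℝ) :
    ‖A.map (fun x : ℝ => (x : ℂ))‖ = ‖A‖ := by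
  simp [Matrix.linfty_opNorm_def]

/-- If `z` is smaller than the modulus of every eigenvalue of `G`, then `z ^ m G ^ (-m)` is small
for large `m`. -/
theorem Matrix.tendsto_pow_mul_norm_inv {n : Type*} [Fintype n] [DecidableEq n]
    {G : Matrix n n ℝ} (hG : IsUnit G) {z : ℝ} (hz : 0 < z)
    (hγ : z < sInf ((fun l : ℂ => ‖l‖) '' spectrum ℂ (G.map (fun x : ℝ => (x : ℂ))))) :
    Filter.Tendsto (fun m : ℕ => z ^ m * ‖(G ^ m)⁻¹‖) Filter.atTop (nhds 0) := by
  set Gc : Matrix n n ℂ := G.map (fun x : ℝ => (x : ℂ)) with hGc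
  set γ := sInf ((fun l : ℂ => ‖l‖) '' spectrum ℂ Gc) with hγdef
  have hmap : ∀ B : Matrix n n ℝ, B.map (fun x : ℝ => (x : ℂ)) =
      Complex.ofRealHom.mapMatrix B := fun B => rfl
  obtain ⟨u, rfl⟩ := hG
  set uc : (Matrix n n ℂ)ˣ :=
    Units.map (Complex.ofRealHom.mapMatrix : Matrix n n ℝ →+* Matrix n n ℂ).toMonoidHom u
  have huc : (uc : Matrix n n ℂ) = Gc := rfl
  have hγ0 : 0 < γ := hz.trans hγ
  have hspec : ∀ l ∈ spectrum ℂ ((uc⁻¹ : (Matrix n n ℂ)ˣ) : Matrix n n ℂ), ‖l‖ ≤ γ⁻¹ := by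
    intro l hl
    have hl0 : l ≠ 0 := spectrum.ne_zero_of_mem_of_unit hl
    have h1 : ((Units.mk0 l hl0 : ℂˣ) : ℂ) ∈ spectrum ℂ ((uc⁻¹ : (Matrix n n ℂ)ˣ) : Matrix n n ℂ) :=
      hl
    rw [spectrum.inv_mem_iff, inv_inv, huc] at h1
    have h2 : γ ≤ ‖l⁻¹‖ := csInf_le ⟨0, by rintro _ ⟨x, _, rfl⟩; exact norm_nonneg x⟩
      ⟨_, h1, by simp⟩
    rw [norm_inv] at h2
    exact (le_inv_comm₀ hγ0 (norm_pos_iff.2 hl0)).1 h2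
  -- The inverse has spectral radius at most `γ⁻¹`, and `r < z⁻¹` makes `z * r < 1`.
  obtain ⟨r, hr1, hr2⟩ := exists_between ((inv_lt_inv₀ hγ0 hz).2 hγ)
  have hr0 : 0 < r := (inv_pos.2 hγ0).trans hr1
  lift r to NNReal using hr0.le
  let c : NNReal := ⟨γ⁻¹, (inv_pos.2 hγ0).le⟩
  have hrad : spectralRadius ℂ ((uc⁻¹ : (Matrix n n ℂ)ˣ) : Matrix n n ℂ) < r := by
    refine lt_of_le_of_lt (b := (c : ℝ≥0∞)) (iSup₂_le fun l hl => ?_) (ENNReal.coe_lt_coe.2 hr1)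
    exact ENNReal.coe_le_coe.2 (hspec l hl)
  have hev := eventually_norm_pow_le_of_spectralRadius_lt hrad
  have hzr : z * r < 1 := by
    have := mul_lt_mul_of_pos_left hr2 hz
    rwa [mul_inv_cancel₀ hz.ne'] at this
  refine squeeze_zero' (Filter.Eventually.of_forall fun m => by positivity) ?_
    (tendsto_pow_atTop_nhds_zero_of_lt_one (by positivity) hzr)
  filter_upwards [hev] with m hm
  rw [mul_pow]
  refine mul_le_mul_of_nonneg_left ?_ (by positivity)
  refine le_trans (le_of_eq ?_) hm
  rw [← Matrix.norm_map_ofReal, ← Units.val_pow_eq_pow_val, ← Matrix.coe_units_inv, hmap,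
    ← Units.val_pow_eq_pow_val]
  congr 1
  rw [inv_pow, ← map_pow]
  rfl

namespace MarkovAdditiveChain

/-! ### The generating function of the scale matrices. -/

section Convergence

variable {E : Type*} [Fintype E]

theorem hasSum_F (M : MarkovAdditiveChain E) {z : ℝ} (hz : 0 < z) (hz1 : z ≤ 1) :
    HasSum (fun m : ℤ => z ^ (-m) • M.A m) (M.F z) := by
  refine Pi.hasSum.2 fun i => Pi.hasSum.2 fun j => ?_
  have hA : Summable fun m : ℤ => M.A m i j :=
    (M.hasSum_row i).summable.comp_injective (i := fun m : ℤ => (m, j)) fun a b h => by simpa using h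
  have hs : Summable fun m : ℤ => z ^ (-m) * M.A m i j := by
    refine Summable.of_nonneg_of_le (fun m => mul_nonneg (by positivity) (M.nonneg _ _ _))
      -- For `z ≤ 1` and `m ≤ 1` the weight `z ^ (-m)` is at most `z⁻¹`.
      (fun m => ?_) (hA.mul_left z⁻¹)
    by_cases hm : m ≤ 1
    · refine mul_le_mul_of_nonneg_right ?_ (M.nonneg _ _ _)
      rw [← zpow_neg_one]
      exact zpow_le_zpow_right_of_le_one₀ hz hz1 (by omega)
    · simp [M.skipFree m (by omega)]
  have h := hs.hasSum
  rw [← (Equiv.neg ℤ).tsum_eq] at h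
  simpa [F] using h

variable [DecidableEq E] {M : MarkovAdditiveChain E}

/-- The matrix of the two-sided upward exit from the strip between `-b` and `a`. -/
noncomputable def exitMat (M : MarkovAdditiveChain E) (a b : ℕ) : Matrix E E ℝ :=
  toMat (fun j => potential M.kernel {s | (a : ℤ) ≤ s.1 ∨ s.1 ≤ -b}
    (Set.indicator {s | (a : ℤ) ≤ s.1 ∧ s.2 = j} 1)) 0

/-- Shift the strip up by `b`: the start is then level `b` between `0` and `a + b`. -/
theorem exitMat_eq (hA : IsUnit (M.A 1)) {a : ℕ} (ha : 1 ≤ a) (b : ℕ) :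
    M.exitMat a b = M.scale b * (M.scale (a + b))⁻¹ := by
  rw [← (exists_scale_inverse hA (N := a + b) (by omega)).2 b (by omega)]
  ext i j
  simp only [exitMat, toMat, Matrix.of_apply]
  have := M.potential_shift {s | ((a + b : ℕ) : ℤ) ≤ s.1 ∨ s.1 ≤ 0}
    (Set.indicator {s | ((a + b : ℕ) : ℤ) ≤ s.1 ∧ s.2 = j} 1) b 0 i
  rw [zero_add] at this
  rw [this]
  congr 2
  · ext s
    simp only [Set.mem_ofPred_eq]
    push_cast
    constructor <;> rintro (h | h) <;> omega
  · ext s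
    by_cases h : (a : ℤ) ≤ s.1 ∧ s.2 = j
    · rw [Set.indicator_of_mem (by exact h), Set.indicator_of_mem]
      · rfl
      · exact ⟨by push_cast; linarith [h.1], h.2⟩
    · rw [Set.indicator_of_notMem (by exact h), Set.indicator_of_notMem]
      rintro ⟨h1, h2⟩
      push_cast at h1
      exact h ⟨by linarith, h2⟩

/-- As the lower barrier recedes the exit probabilities increase to those of ever reaching levels `≥
a`, which by skip-freeness happens first at `a`. -/
theorem tendsto_exitMat (M : MarkovAdditiveChain E) {a : ℕ} :
    Filter.Tendsto (fun b => M.exitMat a b) Filter.atTop (nhds (M.passage 1 ^ a)) := by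
  rw [← passage_natCast]
  refine tendsto_pi_nhds.2 fun i => tendsto_pi_nhds.2 fun j => ?_
  simp only [exitMat, toMat, passage, Matrix.of_apply]
  have hne : M.passageProb a j (0, i) ≠ ⊤ :=
    ((M.passageProb_le_one _ _ _).trans_lt ENNReal.one_lt_top).ne
  refine (ENNReal.tendsto_toReal hne).comp ?_
  set f : ℤ × E → ℝ≥0∞ := Set.indicator {s | (a : ℤ) ≤ s.1 ∧ s.2 = j} 1 with hf
  set D : ℕ → Set (ℤ × E) := fun b => {s | (a : ℤ) ≤ s.1 ∨ s.1 ≤ -b} with hD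
  have hanti : Antitone D := by
    rintro b b' hbb s (hs | hs)
    · exact Or.inl hs
    · exact Or.inr (by omega)
  have h1 : M.passageProb a j (0, i) = potential M.kernel {s | (a : ℤ) ≤ s.1} f (0, i) := by
    refine potential_congr (B := {s | s.1 ≤ a}) ?_ ?_ ?_ (by simp)
    · intro s hs hsD t ht
      apply M.kernel_eq_zero
      have h1 : s.1 ≤ a := hs
      have h2 : ¬ t.1 ≤ a := ht
      have h3 : s.1 ≠ a := hsD
      omega
    · intro s hs
      have h1 : s.1 ≤ a := hs
      simp only [Set.mem_ofPred_eq]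
      omega
    · intro s hs
      have h1 : s.1 ≤ a := hs
      by_cases h : s = ((a : ℤ), j)
      · subst h
        simp [hf]
      · rw [Set.indicator_of_notMem (by exact h), hf, Set.indicator_of_notMem]
        rintro ⟨h2, h3⟩
        exact h (Prod.ext (le_antisymm h1 h2) h3)
  have h2 := potential_eq_iSup (p := M.kernel) (f := f) (D' := {s | (a : ℤ) ≤ s.1}) hanti
    (fun n s hs => Or.inl hs) (fun s hs => ⟨s.1.natAbs + 1, by
      rintro (h | h)
      · exact hs h
      · omega⟩) (0, i)
  rw [h1, h2]
  exact tendsto_atTop_iSup fun b b' hbb => potential_mono (hanti hbb) (fun _ => le_rfl) _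

theorem summable_scale (hA : IsUnit (M.A 1)) {z : ℝ} (hz : 0 < z)
    (hγ : z < sInf ((fun l : ℂ => ‖l‖) '' spectrum ℂ ((M.passage 1).map (fun x : ℝ => (x : ℂ))))) :
    Summable fun n => z ^ n • M.scale n := by
  have hG := isUnit_passage_one hA
  obtain ⟨m, hm, hm1⟩ := (((Matrix.tendsto_pow_mul_norm_inv hG hz hγ).eventually_lt_const
    (one_half_pos (α := ℝ))).and (Filter.eventually_ge_atTop 1)).exists
  have hGm : IsUnit (M.passage 1 ^ m) := hG.pow m
  -- Inversion is continuous at the unit `G ^ m`.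
  have hcont : Filter.Tendsto (fun b => z ^ m * ‖(M.exitMat m b)⁻¹‖) Filter.atTop
      (nhds (z ^ m * ‖(M.passage 1 ^ m)⁻¹‖)) := by
    obtain ⟨u, hu⟩ := hGm
    have h1 := NormedRing.inverse_continuousAt u
    rw [hu] at h1
    have h2 := (h1.tendsto.comp (M.tendsto_exitMat (a := m))).norm.const_mul (z ^ m)
    simpa only [Function.comp_def, Matrix.nonsing_inv_eq_ringInverse] using h2
  obtain ⟨n₀, hn₀⟩ := Filter.eventually_atTop.1 (hcont.eventually_lt_const hm)
  refine Summable.of_norm (summable_of_shift_le_half (m := m) (n₀ := max n₀ 1)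
    (fun n => norm_nonneg _) fun n hn => ?_)
  have hn0 := hn₀ n (le_trans (le_max_left _ _) hn)
  have hn1 : 1 ≤ n := le_trans (le_max_right _ _) hn
  have hu1 := (exists_scale_inverse hA (N := n) hn1).1
  have hu2 := (exists_scale_inverse hA (N := m + n) (by omega)).1
  have hscale : M.scale (n + m) = (M.exitMat m n)⁻¹ * M.scale n := by
    rw [exitMat_eq hA hm1, Matrix.mul_inv_rev, Matrix.nonsing_inv_nonsing_inv _
      ((Matrix.isUnit_iff_isUnit_det _).1 hu2), mul_assoc, Matrix.nonsing_inv_mul _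
      ((Matrix.isUnit_iff_isUnit_det _).1 hu1), mul_one, add_comm]
  rw [hscale, norm_smul, norm_smul, pow_add, Real.norm_of_nonneg (by positivity),
    Real.norm_of_nonneg (by positivity)]
  have h1 := norm_mul_le (M.exitMat m n)⁻¹ (M.scale n)
  calc z ^ n * z ^ m * ‖(M.exitMat m n)⁻¹ * M.scale n‖
      ≤ z ^ n * z ^ m * (‖(M.exitMat m n)⁻¹‖ * ‖M.scale n‖) := by gcongr
    _ = (z ^ m * ‖(M.exitMat m n)⁻¹‖) * (z ^ n * ‖M.scale n‖) := by ring
    _ ≤ (1 / 2) * (z ^ n * ‖M.scale n‖) := by gcongr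
    _ = z ^ n * ‖M.scale n‖ / 2 := by ring

theorem hasSum_scale_int (hA : IsUnit (M.A 1)) {z : ℝ} (hz : 0 < z) (x : ℤ) :
    HasSum (fun m : ℤ => (z ^ (-m) • M.A m) * (z ^ (x + m) • M.scale (x + m).toNat))
      (z ^ x • M.scale x.toNat + if x = 0 then 1 else 0) := by
  have hneg : ∀ x : ℤ, x ≤ 0 → M.scale x.toNat = 0 := fun x hx => by simp [Int.toNat_of_nonpos hx]
  rcases lt_or_ge x 0 with hx | hx
  · have h0 : ∀ m : ℤ, (z ^ (-m) • M.A m) * (z ^ (x + m) • M.scale (x + m).toNat) = 0 := by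
      intro m
      by_cases hm : m ≤ 1
      · rw [hneg _ (by omega), smul_zero, mul_zero]
      · rw [M.skipFree m (by omega), smul_zero, zero_mul]
    rw [hneg x hx.le, if_neg hx.ne, add_zero, smul_zero]
    simp only [h0]
    exact hasSum_zero
  · lift x to ℕ using hx
    have h1 := (hasSum_scale hA x).const_smul (z ^ x)
    have h2 : ∀ m : ℤ, (z ^ (-m) • M.A m) * (z ^ ((x : ℤ) + m) • M.scale ((x : ℤ) + m).toNat) =
        z ^ x • (M.A m * M.scale ((x : ℤ) + m).toNat) := by
      intro m
      rw [smul_mul_smul_comm, ← zpow_add₀ hz.ne', neg_add_cancel_comm_assoc, zpow_natCast]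
    have h3 : z ^ (x : ℤ) • M.scale (x : ℤ).toNat + (if (x : ℤ) = 0 then 1 else 0) =
        z ^ x • (M.scale x + if x = 0 then 1 else 0) := by
      rw [zpow_natCast, Int.toNat_natCast, smul_add]
      congr 1
      by_cases hx : x = 0 <;> simp [hx]
    simp only [h2]
    rw [h3]
    exact h1

/-- Convolution of summable families over `ℤ` in a Banach algebra. -/
theorem _root_.HasSum.mul_convolution {R : Type*} [NormedRing R] [CompleteSpace R] {a w c : ℤ → R}
    {s t : R} (ha : HasSum a s) (hw : HasSum w t) (ha' : Summable fun m => ‖a m‖)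
    (hw' : Summable fun m => ‖w m‖) (h : ∀ x, HasSum (fun m => a m * w (x + m)) (c x)) :
    HasSum c (s * t) := by
  have hprod := ha.mul hw (summable_mul_of_summable_norm ha' hw')
  -- The pair `(x, m)` goes to `(m, x + m)`, so the fibre over `x` is the sum defining `c x`.
  let e : ℤ × ℤ ≃ ℤ × ℤ :=
    { toFun := fun q => (q.2, q.1 + q.2)
      invFun := fun q => (q.2 - q.1, q.1)
      left_inv := fun q => by simp
      right_inv := fun q => by simp }
  rw [← e.hasSum_iff] at hprod
  exact hprod.prod_fiberwise h

/-- The weighted harmonicity equation, summed over all levels, reads `F(z) Ŵ = Ŵ + I`. -/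
theorem F_sub_one_mul_tsum (hA : IsUnit (M.A 1)) {z : ℝ} (hz : 0 < z) (hz1 : z ≤ 1)
    (hs : Summable fun n => z ^ n • M.scale n) :
    (M.F z - 1) * ∑' n, z ^ n • M.scale n = 1 := by
  have hw : HasSum (fun x : ℤ => z ^ x • M.scale x.toNat) (∑' n, z ^ n • M.scale n) := by
    refine (Nat.cast_injective.hasSum_iff (f := fun x : ℤ => z ^ x • M.scale x.toNat)
      (g := fun n : ℕ => (n : ℤ)) fun x hx => ?_).1 ?_
    · rw [Int.toNat_of_nonpos, scale_zero, smul_zero]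
      by_contra h
      exact hx ⟨x.toNat, by simp; omega⟩
    · have h := hs.hasSum
      simpa only [Function.comp_def, zpow_natCast, Int.toNat_natCast] using h
  have hF := M.hasSum_F hz hz1
  have h1 := hF.mul_convolution hw hF.summable.norm hw.summable.norm (hasSum_scale_int hA hz)
  have h2 := hw.add (hasSum_ite_eq (0 : ℤ) (1 : Matrix E E ℝ))
  rw [sub_mul, one_mul, h1.unique h2, add_sub_cancel_left]

end Convergence

end MarkovAdditiveChain

namespace MarkovAdditiveChain

/-! ### Bounds on `γ`, uniqueness, and transfer to the realized process. -/

section Eigenvalues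

open scoped Matrix.Norms.Operator

variable {E : Type*} [Fintype E] {M : MarkovAdditiveChain E}

theorem sum_passage_one_le_one (M : MarkovAdditiveChain E) (i : E) :
    ∑ j, M.passage 1 i j ≤ 1 := by
  classical
  have h := M.potential_level 1 (fun _ => 1) (0, i)
  have h1 : (fun t : ℤ × E => if t.1 = 1 then (1 : ℝ≥0∞) else 0) =
      Set.indicator {s | s.1 = 1} 1 := by
    ext t
    by_cases ht : t.1 = 1 <;> simp [ht]
  rw [h1] at h
  simp only [mul_one] at h
  have h2 : ∑ k, M.passageProb 1 k (0, i) ≤ 1 := h ▸ M.potential_le_one subset_rfl _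
  simp only [passage, Matrix.of_apply]
  rw [← ENNReal.toReal_sum fun k _ => ((M.passageProb_le_one _ _ _).trans_lt ENNReal.one_lt_top).ne]
  exact ENNReal.toReal_mono ENNReal.one_ne_top h2

theorem norm_passage_one_le_one (M : MarkovAdditiveChain E) : ‖M.passage 1‖ ≤ 1 := by
  rw [Matrix.linfty_opNorm_def]
  refine NNReal.coe_le_one.2 (Finset.sup_le fun i _ => ?_)
  rw [← NNReal.coe_le_one]
  push_cast
  refine le_trans (le_of_eq (Finset.sum_congr rfl fun j _ => ?_)) (M.sum_passage_one_le_one i)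
  exact Real.norm_of_nonneg ENNReal.toReal_nonneg

variable [DecidableEq E] [Nonempty E]

/-- The spectrum is finite and nonempty, so the infimum is attained: at a nonzero eigenvalue as `G`
is invertible, of modulus at most `‖G‖ ≤ 1` as `G` is substochastic. The upper bound puts `(0, γ)`
inside the range where `F` is known to converge. -/
theorem sInf_norm_spectrum_passage (hA : IsUnit (M.A 1)) :
    0 < sInf ((fun l : ℂ => ‖l‖) '' spectrum ℂ ((M.passage 1).map (fun x : ℝ => (x : ℂ)))) ∧
      sInf ((fun l : ℂ => ‖l‖) '' spectrum ℂ ((M.passage 1).map (fun x : ℝ => (x : ℂ)))) ≤ 1 := by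
  set Gc := (M.passage 1).map (fun x : ℝ => (x : ℂ)) with hGc
  have hunit : IsUnit Gc :=
    (isUnit_passage_one hA).map (Complex.ofRealHom.mapMatrix : Matrix E E ℝ →+* Matrix E E ℂ)
  have hne : (spectrum ℂ Gc).Nonempty :=
    spectrum.nonempty_of_isAlgClosed_of_finiteDimensional ℂ Gc
  obtain ⟨l, hl, hl'⟩ := (hne.image (fun l : ℂ => ‖l‖)).csInf_mem (Gc.finite_spectrum.image _)
  simp only at hl'
  rw [← hl']
  refine ⟨norm_pos_iff.2 ?_, ?_⟩
  · rintro rfl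
    exact spectrum.zero_notMem ℂ hunit hl
  · refine (spectrum.norm_le_norm_of_mem hl).trans ?_
    rw [hGc, Matrix.norm_map_ofReal]
    exact M.norm_passage_one_le_one

end Eigenvalues

section Uniqueness

variable {E Ω : Type*} [Fintype E] [DecidableEq E] [MeasurableSpace Ω] {P : E → Measure Ω}
  {Z : ℕ → Ω → State E}

/-- Solutions of the exit problem are unique up to a constant invertible right factor. -/
theorem SolvesExitUp.iff_eq_mul {W : ℕ → Matrix E E ℝ} (hW : SolvesExitUp P Z W)
    (W' : ℕ → Matrix E E ℝ) :
    SolvesExitUp P Z W' ↔ ∃ C : Matrix E E ℝ, IsUnit C ∧ ∀ n, W' n = W n * C := by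
  constructor
  · intro hW'
    have h1 := hW.isUnit 1 le_rfl
    have h1' := hW'.isUnit 1 le_rfl
    -- The exit identity with `b = 1` gives `W(1) W(n)⁻¹ = W'(1) W'(n)⁻¹` for `n ≥ 2`, which forces
    -- this constant.
    refine ⟨(W 1)⁻¹ * W' 1, (Matrix.isUnit_nonsing_inv_iff.2 h1).mul h1', fun n => ?_⟩
    rcases n with _ | _ | n
    · rw [hW.zero, hW'.zero, zero_mul]
    · rw [← mul_assoc, Matrix.mul_nonsing_inv _ ((Matrix.isUnit_iff_isUnit_det _).1 h1), one_mul]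
    · have hn := (Matrix.isUnit_iff_isUnit_det _).1 (hW.isUnit (n + 1 + 1) (by omega))
      have hn' := (Matrix.isUnit_iff_isUnit_det _).1 (hW'.isUnit (n + 1 + 1) (by omega))
      have h := (hW.exit (n + 1) 1 (by omega) one_pos).symm.trans
        (hW'.exit (n + 1) 1 (by omega) one_pos)
      have h2 : W' 1 = W 1 * (W (n + 1 + 1))⁻¹ * W' (n + 1 + 1) := by
        rw [h, mul_assoc, Matrix.nonsing_inv_mul _ hn', mul_one]
      rw [h2, mul_assoc, Matrix.nonsing_inv_mul_cancel_left _ _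
        ((Matrix.isUnit_iff_isUnit_det _).1 h1), Matrix.mul_nonsing_inv_cancel_left _ _ hn]
  · rintro ⟨C, hC, h⟩
    refine ⟨by rw [h, hW.zero, zero_mul], fun n hn => h n ▸ (hW.isUnit n hn).mul hC,
      fun a b ha hb => ?_⟩
    rw [hW.exit a b ha hb, h, h, Matrix.mul_inv_rev, mul_assoc, Matrix.mul_nonsing_inv_cancel_left _ _
      ((Matrix.isUnit_iff_isUnit_det _).1 hC)]

end Uniqueness

section Realization

variable {E : Type*} [Fintype E] {M : MarkovAdditiveChain E}
  {Ω : Type*} [MeasurableSpace Ω] {P : E → Measure Ω} [∀ i, IsProbabilityMeasure (P i)]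
  {Z : ℕ → Ω → State E}

theorem IsRealization.hitMatrix_eq (hZ : M.IsRealization P Z) (x : ℤ) :
    hitMatrix P Z x = M.passage x := by
  ext i j
  exact hZ.hitMatrix_apply x i j

theorem IsRealization.G_eq (hZ : M.IsRealization P Z) : G P Z = M.passage 1 :=
  hZ.hitMatrix_eq 1

theorem IsRealization.exitUp_eq (hZ : M.IsRealization P Z) {a : ℕ} (ha : 0 < a) (b : ℕ) :
    exitUp P Z a b = M.exitMat a b := by
  ext i j
  exact hZ.exitUp_apply a b ha i j

variable [DecidableEq E]

theorem IsRealization.solvesExitUp_scale (hZ : M.IsRealization P Z) (hA : IsUnit (M.A 1)) :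
    SolvesExitUp P Z M.scale where
  zero := M.scale_zero
  isUnit _ hn := (exists_scale_inverse hA hn).1
  exit a b ha _ := by rw [hZ.exitUp_eq ha, exitMat_eq hA ha]

end Realization

end MarkovAdditiveChain

/-! ### The theorem, with `scale` as witness. -/

theorem mainTheorem1 {E : Type*} [Fintype E] [DecidableEq E] [Nonempty E]
    (M : MarkovAdditiveChain E) (hA : IsUnit (M.A 1))
    {Ω : Type*} [MeasurableSpace Ω] (P : E → Measure Ω) [∀ i, IsProbabilityMeasure (P i)]
    (Z : ℕ → Ω → MarkovAdditiveChain.State E) (hZ : M.IsRealization P Z) :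
    IsUnit (MarkovAdditiveChain.G P Z) ∧
    0 < MarkovAdditiveChain.gamma P Z ∧
    (∀ n, 1 ≤ n → ∀ i j, MarkovAdditiveChain.LUpTo P Z n i j ≠ ⊤) ∧
    ∃ W : ℕ → Matrix E E ℝ,
      -- existence: exit identity and generating function
      MarkovAdditiveChain.SolvesExitUp P Z W ∧
      MarkovAdditiveChain.HasScaleTransform P Z M W ∧
      -- uniqueness: up to an invertible right factor, which the transform fixes
      (∀ W' : ℕ → Matrix E E ℝ, MarkovAdditiveChain.SolvesExitUp P Z W' ↔
        ∃ C : Matrix E E ℝ, IsUnit C ∧ ∀ n, W' n = W n * C) ∧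
      (∀ W' : ℕ → Matrix E E ℝ, MarkovAdditiveChain.SolvesExitUp P Z W' →
        MarkovAdditiveChain.HasScaleTransform P Z M W' → W' = W) ∧
      -- representation by the infinite-horizon occupation matrix, when that matrix is finite
      ((∀ i j, MarkovAdditiveChain.L P Z i j ≠ ⊤) →
        ∀ n : ℕ, W n = ((MarkovAdditiveChain.G P Z)⁻¹ ^ n -
          MarkovAdditiveChain.hitMatrix P Z (-(n : ℤ))) *
            (MarkovAdditiveChain.L P Z).map ENNReal.toReal) ∧
      -- representation by the occupation matrix up to the hitting time of level `n`
      (∀ n : ℕ, 1 ≤ n → W n = (MarkovAdditiveChain.G P Z)⁻¹ ^ n *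
        (MarkovAdditiveChain.LUpTo P Z n).map ENNReal.toReal) := by
  obtain ⟨hγ0, hγ1⟩ := MarkovAdditiveChain.sInf_norm_spectrum_passage hA
  have hγ : MarkovAdditiveChain.gamma P Z =
      sInf ((fun l : ℂ => ‖l‖) '' spectrum ℂ ((M.passage 1).map (fun x : ℝ => (x : ℂ)))) := by
    rw [MarkovAdditiveChain.gamma, hZ.G_eq]
  rw [← hγ] at hγ0 hγ1
  have hinv : ∀ n : ℕ, M.passage 1 ^ (-(n : ℤ)) = (MarkovAdditiveChain.G P Z)⁻¹ ^ n := by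
    intro n
    rw [hZ.G_eq, Matrix.zpow_neg_natCast, Matrix.inv_pow']
  have hexit := hZ.solvesExitUp_scale hA
  have htrans : MarkovAdditiveChain.HasScaleTransform P Z M M.scale := by
    intro z hz hzγ
    have hs := MarkovAdditiveChain.summable_scale hA hz (hγ ▸ hzγ)
    have h := MarkovAdditiveChain.F_sub_one_mul_tsum hA hz (hzγ.le.trans hγ1) hs
    refine ⟨IsUnit.of_mul_eq_one _ h, ?_⟩
    rw [Matrix.inv_eq_right_inv h]
    exact hs.hasSum
  refine ⟨hZ.G_eq ▸ MarkovAdditiveChain.isUnit_passage_one hA, hγ0, fun n hn i j => ?_, M.scale,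
    hexit, htrans, hexit.iff_eq_mul, fun W' hW' hT => ?_, fun hL n => ?_, fun n hn => ?_⟩
  · obtain ⟨c, hc, hle⟩ := MarkovAdditiveChain.exists_potential_le hA hn
    rw [hZ.LUpTo_apply]
    exact ne_top_of_le_ne_top hc (hle j _)
  · obtain ⟨C, hC, h⟩ := (hexit.iff_eq_mul W').1 hW'
    -- One value of `z` suffices: there `(F(z) - I)⁻¹ C = (F(z) - I)⁻¹`, so `C = 1`.
    obtain ⟨z, hz, hzγ⟩ := exists_between hγ0
    obtain ⟨hF, hsum⟩ := htrans z hz hzγ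
    have h1 := (hT z hz hzγ).2
    simp only [h, ← smul_mul_assoc] at h1
    have h2 := h1.unique (hsum.mul_right C)
    have hFi := Matrix.isUnit_nonsing_inv_iff.2 hF
    have hC1 : C = 1 := hFi.mul_left_cancel (h2.symm.trans (mul_one _).symm)
    ext1 n
    rw [h, hC1, mul_one]
  · rw [MarkovAdditiveChain.scale_eq_sub_mul hA (fun i j => hZ.L_apply i j ▸ hL i j) n, hinv,
      hZ.hitMatrix_eq]
    congr 1
    ext i j
    exact congrArg ENNReal.toReal (hZ.L_apply i j).symm
  · rw [MarkovAdditiveChain.scale_eq_passage_mul hA hn, hinv]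
    congr 1
    ext i j
    exact congrArg ENNReal.toReal (hZ.LUpTo_apply n i j).symm
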